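/- Let $\mu$ be a $\sigma$-finite measure on a measurable space $\mathcal X$, and let $\{f_\theta:\theta\in\Theta\}$, $\Theta\subseteq\mathbb R^p$, be a family of probability densities with respect to $\mu$. Let $\beta\ge 0$ and $\theta_0\in\Theta$. Write $s_\theta(x)=\frac{\partial}{\partial\theta}\log f_\theta(x)$ and $$\xi_\beta(\theta)=\int s_\theta f_\theta^{\beta+1}d\mu,\qquad J_\beta(\theta)=\int s_\theta s_\theta^Tf_\theta^{\beta+1}d\mu,\qquad K_\beta(\theta)=\int s_\theta s_\theta^Tf_\theta^{2\beta+1}d\mu-\xi_\beta(\theta)\xi_\beta(\theta)^T,$$ $$u_\beta(x,\theta)=s_\theta(x)f_\theta(x)^\beta-\xi_\beta(\theta),\qquad U_{\beta,n}(\theta)=\frac1n\sum_{i=1}^nu_\beta(X_i,\theta),\qquad R_{\beta,n}(\theta_0)=n\,U_{\beta,n}(\theta_0)^TK_\beta(\theta_0)^{-1}U_{\beta,n}(\theta_0).$$ Assume the following regularity conditions, for some open set $\Omega$ with $\theta_0\in\Omega\subseteq\Theta$. 1. The set $\{x: f_\theta(x)>0\}$ is the same for all $\theta\in\Theta$. 2.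 For almost all $x$ in this common support, $\theta\mapsto f_\theta(x)$ is three times continuously differentiable on $\Omega$. 3. The integrals $\int f_\theta^{\beta+1}d\mu$ and $\int f_\theta^{\beta}f_{\theta_0}d\mu$ are three times differentiable in $\theta\in\Omega$, and the derivatives may be taken under the integral sign. 4. $J_\beta(\theta_0)$ is positive definite. 5. Let $V_\theta(x)=\int f_\theta^{1+\beta}d\mu-(1+\tfrac1\beta)f_\theta(x)^\beta$ if $\beta>0$, and $V_\theta(x)=-\log f_\theta(x)$ if $\beta=0$. For all $j,k,l\in\{1,\dots,p\}$ there is a function $\zeta_{jkl}$ with $\int|\zeta_{jkl}|f_{\theta_0}d\mu<\infty$ such that, for almost all $x$ in the common support, $\left|\frac{\partial^3}{\partial\theta_j\partial\theta_k\partial\theta_l}V_\theta(x)\right|\le\zeta_{jkl}(x)$ for all $\theta\in\Omega$. 6. $K_\beta(\theta_0)$ is positive definite, and $K_\beta$ is continuous at $\theta_0$. Let $d\in\mathbb R^p$, and let $\theta_n\in\Theta$ with $\theta_n=\theta_0+n^{-1/2}d$ for all sufficiently large $n$. Assume that these local alternatives are contiguous to the null hypothesis: if $A_n\subseteq\mathcal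 X^n$ are measurable and $P_{\theta_0}^{\otimes n}(A_n)\to0$, then $P_{\theta_n}^{\otimes n}(A_n)\to0$, where $P_\theta$ is the distribution with density $f_\theta$. If, for each $n$, the observations $X_1,\dots,X_n$ are independent with density $f_{\theta_n}$, then $R_{\beta,n}(\theta_0)$ converges in law, as $n\to\infty$, to the noncentral chi-squared distribution with $p$ degrees of freedom and noncentrality parameter $$\delta_\beta(\theta_0,d)=d^TJ_\beta(\theta_0)K_\beta(\theta_0)^{-1}J_\beta(\theta_0)\,d.$$ (This is the distribution of $\sum_{i=1}^pY_i^2$ for independent $Y_i\sim N(m_i,1)$ with $\sum_{i=1}^p m_i^2=\delta_\beta(\theta_0,d)$.) -/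

import Mathlib

open MeasureTheory ProbabilityTheory Filter Topology

noncomputable section

/-- The noncentral chi-squared law with `p` degrees of freedom and noncentrality `δ ≥ 0`: the law of
`∑ i, Y i ^ 2` for independent normal variables `Y i` with variance one whose squared means sum up
to `δ`. All means are taken equal to `√(δ / p)`; by `noncentralChiSquared_eq` below, only the sum of
their squares matters. -/
def noncentralChiSquared (p : ℕ) (δ : ℝ) : Measure ℝ :=
  (Measure.pi fun _ : Fin p => gaussianReal (√(δ / p)) 1).map fun y => ∑ i, y i ^ 2

instance (p : ℕ) (δ : ℝ) : IsProbabilityMeasure (noncentralChiSquared p δ) :=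
  Measure.isProbabilityMeasure_map (Measurable.aemeasurable (by fun_prop))

/-- A shifted standard Gaussian vector has a squared norm whose law depends on the shift only
through its norm. -/
theorem map_norm_sq_stdGaussian_congr {p : ℕ} (m m' : EuclideanSpace ℝ (Fin p))
    (h : ‖m‖ = ‖m'‖) :
    (stdGaussian (EuclideanSpace ℝ (Fin p))).map (fun z => ‖z + m‖ ^ 2) =
      (stdGaussian (EuclideanSpace ℝ (Fin p))).map (fun z => ‖z + m'‖ ^ 2) := by
  set L := Submodule.reflection (ℝ ∙ (m - m'))ᗮ with hL
  have hm : L m = m' := Submodule.reflection_sub h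
  conv_rhs => rw [← stdGaussian_map L]
  rw [Measure.map_map (by fun_prop) L.continuous.measurable]
  congr 1
  funext z
  simp only [Function.comp_apply]
  rw [← hm, ← map_add, L.norm_map]

theorem map_norm_sq_stdGaussian_add {p : ℕ} (m : EuclideanSpace ℝ (Fin p)) :
    (stdGaussian (EuclideanSpace ℝ (Fin p))).map (fun z => ‖z + m‖ ^ 2) =
      (Measure.pi fun i : Fin p => gaussianReal (m i) 1).map fun y => ∑ i, y i ^ 2 := by
  have h1 : (Measure.pi fun i : Fin p => gaussianReal (m i) 1) =
      (Measure.pi fun _ : Fin p => gaussianReal 0 1).map (fun z i => z i + m i) := by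
    rw [Measure.pi_map_pi (f := fun i (z : ℝ) => z + m i)
      (fun i => Measurable.aemeasurable (by fun_prop))]
    congr 1
    funext i
    rw [gaussianReal_map_add_const, zero_add]
  rw [h1, ← map_pi_eq_stdGaussian, Measure.map_map (by fun_prop) (by fun_prop),
    Measure.map_map (by fun_prop) (by fun_prop)]
  congr 1
  funext z
  simp [EuclideanSpace.real_norm_sq_eq]

/-- The sum of the squares of independent normal variables with variance one and means `m i` has the
law `noncentralChiSquared p (∑ i, m i ^ 2)`. -/
theorem noncentralChiSquared_eq {p : ℕ} (m : Fin p → ℝ) :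
    (Measure.pi fun i : Fin p => gaussianReal (m i) 1).map (fun y => ∑ i, y i ^ 2) =
      noncentralChiSquared p (∑ i, m i ^ 2) := by
  set c : ℝ := √((∑ i, m i ^ 2) / p) with hc
  have h := map_norm_sq_stdGaussian_congr (WithLp.toLp 2 m) (WithLp.toLp 2 fun _ : Fin p => c) ?_
  · rw [map_norm_sq_stdGaussian_add, map_norm_sq_stdGaussian_add] at h
    exact h
  · rw [EuclideanSpace.norm_eq, EuclideanSpace.norm_eq]
    congr 1
    rcases Nat.eq_zero_or_pos p with rfl | hp
    · simp
    · have hp' : (p : ℝ) ≠ 0 := by positivity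
      have hs : 0 ≤ ∑ i, m i ^ 2 := Finset.sum_nonneg fun i _ => sq_nonneg _
      simp only [Real.norm_eq_abs, sq_abs, Finset.sum_const, Finset.card_univ, Fintype.card_fin,
        nsmul_eq_mul, hc]
      rw [Real.sq_sqrt (by positivity)]
      field_simp

/-- A parametric family of probability densities `f θ`, `θ ∈ Θ ⊆ ℝᵖ`, with respect to the dominating
measure `μ`. Nothing is asked of `f θ` for `θ ∉ Θ`. -/
structure DensityModel {𝓧 : Type*} [MeasurableSpace 𝓧] (μ : Measure 𝓧) (p : ℕ) where
  Θ : Set (EuclideanSpace ℝ (Fin p))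
  f : EuclideanSpace ℝ (Fin p) → 𝓧 → ℝ
  measurable_f : ∀ θ ∈ Θ, Measurable (f θ)
  f_nonneg : ∀ θ ∈ Θ, ∀ x, 0 ≤ f θ x
  lintegral_f : ∀ θ ∈ Θ, ∫⁻ x, ENNReal.ofReal (f θ x) ∂μ = 1

namespace DensityModel

variable {𝓧 : Type*} [MeasurableSpace 𝓧] {μ : Measure 𝓧} {p : ℕ} (M : DensityModel μ p)

/-- The distribution with density `f θ`. -/
def law (θ : M.Θ) : Measure 𝓧 := μ.withDensity fun x => ENNReal.ofReal (M.f θ x)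

instance (θ : M.Θ) : IsProbabilityMeasure (M.law θ) :=
  ⟨by rw [law, withDensity_apply _ MeasurableSet.univ, Measure.restrict_univ,
    M.lintegral_f θ θ.2]⟩

/-- The joint law of an i.i.d. sample `X 0, …, X (n - 1)` from the density `f θ`. -/
def sampleLaw (n : ℕ) (θ : M.Θ) : Measure (Fin n → 𝓧) := Measure.pi fun _ => M.law θ

instance (n : ℕ) (θ : M.Θ) : IsProbabilityMeasure (M.sampleLaw n θ) := by
  unfold sampleLaw; infer_instance

/-- The likelihood score `s_θ(x) = ∂/∂θ log f_θ(x)`. -/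
def score (θ : EuclideanSpace ℝ (Fin p)) (x : 𝓧) : EuclideanSpace ℝ (Fin p) :=
  gradient (fun t => Real.log (M.f t x)) θ

/-- `ξ_β(θ) = ∫ s_θ f_θ^(β+1)`. -/
def xi (β : ℝ) (θ : EuclideanSpace ℝ (Fin p)) : Fin p → ℝ :=
  fun i => ∫ x, M.score θ x i * M.f θ x ^ (β + 1) ∂μ

/-- `J_β(θ) = ∫ s_θ s_θᵀ f_θ^(β+1)`. -/
def J (β : ℝ) (θ : EuclideanSpace ℝ (Fin p)) : Matrix (Fin p) (Fin p) ℝ :=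
  Matrix.of fun i j => ∫ x, M.score θ x i * M.score θ x j * M.f θ x ^ (β + 1) ∂μ

/-- `K_β(θ) = ∫ s_θ s_θᵀ f_θ^(2β+1) - ξ_β(θ) ξ_β(θ)ᵀ`. -/
def K (β : ℝ) (θ : EuclideanSpace ℝ (Fin p)) : Matrix (Fin p) (Fin p) ℝ :=
  Matrix.of fun i j =>
    (∫ x, M.score θ x i * M.score θ x j * M.f θ x ^ (2 * β + 1) ∂μ) - M.xi β θ i * M.xi β θ j

/-- `u_β(x, θ) = s_θ(x) f_θ(x)^β - ∫ s_θ f_θ^(β+1)`. -/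
def u (β : ℝ) (x : 𝓧) (θ : EuclideanSpace ℝ (Fin p)) : Fin p → ℝ :=
  fun i => M.score θ x i * M.f θ x ^ β - M.xi β θ i

/-- The β-score statistic `U_{β,n}(θ) = (1/n) ∑ i, u_β(X i, θ)`. -/
def U (β : ℝ) (n : ℕ) (θ : EuclideanSpace ℝ (Fin p)) (X : Fin n → 𝓧) : Fin p → ℝ :=
  (n : ℝ)⁻¹ • ∑ i, M.u β (X i) θ

/-- The Rao-type statistic `R_{β,n}(θ) = n U_{β,n}(θ)ᵀ K_β(θ)⁻¹ U_{β,n}(θ)`. -/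
def R (β : ℝ) (n : ℕ) (θ : EuclideanSpace ℝ (Fin p)) (X : Fin n → 𝓧) : ℝ :=
  n * (M.U β n θ X ⬝ᵥ (M.K β θ)⁻¹.mulVec (M.U β n θ X))

/-- The density power divergence loss of `f θ` at one observation `x`:
`∫ f_θ^(1+β) - (1 + 1/β) f_θ(x)^β` for `β > 0`, and `-log f_θ(x)` for `β = 0`. -/
def loss (β : ℝ) (θ : EuclideanSpace ℝ (Fin p)) (x : 𝓧) : ℝ :=
  if β = 0 then -Real.log (M.f θ x)
  else (∫ y, M.f θ y ^ (1 + β) ∂μ) - (1 + 1 / β) * M.f θ x ^ β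

end DensityModel

/-- On the open set `Ω`, the integral `θ ↦ ∫ h θ x ∂μ` is three times differentiable, and its partial
derivatives up to order three are obtained by differentiating under the integral sign. -/
structure ThriceDiffUnderIntegral {𝓧 : Type*} [MeasurableSpace 𝓧] (μ : Measure 𝓧) {p : ℕ}
    (Ω : Set (EuclideanSpace ℝ (Fin p))) (h : EuclideanSpace ℝ (Fin p) → 𝓧 → ℝ) : Prop where
  differentiableAt : ∀ k < 3, ∀ θ ∈ Ω,
    DifferentiableAt ℝ (iteratedFDeriv ℝ k fun t => ∫ x, h t x ∂μ) θ
  integrable : ∀ k ≤ 3, ∀ θ ∈ Ω, ∀ v : Fin k → EuclideanSpace ℝ (Fin p),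
    Integrable (fun x => iteratedFDeriv ℝ k (fun t => h t x) θ v) μ
  iteratedFDeriv_eq : ∀ k ≤ 3, ∀ θ ∈ Ω, ∀ v : Fin k → EuclideanSpace ℝ (Fin p),
    iteratedFDeriv ℝ k (fun t => ∫ x, h t x ∂μ) θ v =
      ∫ x, iteratedFDeriv ℝ k (fun t => h t x) θ v ∂μ

/-- The regularity conditions of Basu et al. on the model, at the density `f θ₀`. -/
structure BasuConditions {𝓧 : Type*} [MeasurableSpace 𝓧] {μ : Measure 𝓧} {p : ℕ}
    (M : DensityModel μ p) (β : ℝ) (θ₀ : EuclideanSpace ℝ (Fin p))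
    (Ω : Set (EuclideanSpace ℝ (Fin p))) : Prop where
  isOpen : IsOpen Ω
  subset : Ω ⊆ M.Θ
  mem : θ₀ ∈ Ω
  /-- all densities have the same support -/
  support_eq : ∀ θ ∈ M.Θ, {x | 0 < M.f θ x} = {x | 0 < M.f θ₀ x}
  /-- smoothness in the parameter -/
  contDiffOn : ∀ᵐ x ∂μ, 0 < M.f θ₀ x → ContDiffOn ℝ 3 (fun t => M.f t x) Ω
  /-- three derivatives may be taken under the integral signs -/
  diff_integral : ThriceDiffUnderIntegral μ Ω fun t x => M.f t x ^ (β + 1)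
  diff_integral_mul : ThriceDiffUnderIntegral μ Ω fun t x => M.f t x ^ β * M.f θ₀ x
  /-- nondegeneracy -/
  posDef_J : (M.J β θ₀).PosDef
  /-- the third partial derivatives of the loss are dominated on `Ω` -/
  third_deriv_le : ∀ j k l : Fin p, ∃ ζ : 𝓧 → ℝ,
    Integrable (fun x => ζ x * M.f θ₀ x) μ ∧
      ∀ᵐ x ∂μ, 0 < M.f θ₀ x → ∀ θ ∈ Ω,
        |iteratedFDeriv ℝ 3 (fun t => M.loss β t x) θ
          ![EuclideanSpace.single j 1, EuclideanSpace.single k 1, EuclideanSpace.single l 1]| ≤ ζ x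

/-- `Q n` is contiguous to `P n` (Le Cam): events of asymptotic probability zero under `P n` have
asymptotic probability zero under `Q n`. -/
def Contiguous {S : ℕ → Type*} [∀ n, MeasurableSpace (S n)] (Q P : ∀ n, Measure (S n)) : Prop :=
  ∀ A : ∀ n, Set (S n), (∀ n, MeasurableSet (A n)) →
    Tendsto (fun n => P n (A n)) atTop (𝓝 0) → Tendsto (fun n => Q n (A n)) atTop (𝓝 0)

end

/-! Under the alternative `θ n` the score that is exactly centred is the one evaluated at `θ n`, not
at `θ₀`. The proof studies that one first and then moves the parameter; no expansion of likelihood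
ratios is needed.

Central limit theorem along the alternatives (`tendsto_integral_exp_scaledScore`): `u β · (θ n)` has
mean zero and covariance `K β (θ n)` under `f (θ n)`. Continuity of `K` makes the second moments
converge. Together with pointwise convergence of densities and scores, Pratt's lemma then gives the
second order expansion of the characteristic function, and this replaces a Lindeberg condition.

Change of parameter (`tendsto_sampleLaw_abs_scaledScore_sub`): the score is, up to the factor `-(β +
1)`, the gradient of the loss. A Taylor expansion with dominated third derivatives and the law of
large numbers show that, under the null law, the normalised scores at `θ₀` and `θ n` differ by `J d
+ o(1)`. Contiguity transfers this to the law under `θ n`.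

By Slutsky's theorem the normalised score at `θ₀` is asymptotically `N(J d, K)`. If `K⁻¹ = Bᵀ B`,
the statistic is the squared norm of the score whitened by `B`. Its limit is `‖Z + B J d‖²` with `Z`
standard Gaussian, and by rotation invariance only `‖B J d‖² = dᵀ J K⁻¹ J d` matters. -/

open MeasureTheory ProbabilityTheory Filter Topology

noncomputable section

/-! ### Limit theorems for integrals, triangular arrays and contiguous laws. -/

section GeneralProbability

/-- **Scheffé's lemma** for nonnegative functions with converging integrals. -/
theorem tendsto_integral_abs_sub_of_tendsto_integral {α : Type*} [MeasurableSpace α]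
    {μ : Measure α} {G : ℕ → α → ℝ} {g : α → ℝ} (hGnn : ∀ᶠ n in atTop, ∀ᵐ x ∂μ, 0 ≤ G n x)
    (hG : ∀ᶠ n in atTop, Integrable (G n) μ) (hg : Integrable g μ)
    (hlim : ∀ᵐ x ∂μ, Tendsto (fun n => G n x) atTop (𝓝 (g x)))
    (hint : Tendsto (fun n => ∫ x, G n x ∂μ) atTop (𝓝 (∫ x, g x ∂μ))) :
    Tendsto (fun n => ∫ x, |G n x - g x| ∂μ) atTop (𝓝 0) := by
  -- Since `|a| = a + 2 a⁻`, only the positive part of `g - G n` needs a dominating function, and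
  -- `|g|` is one because `G n ≥ 0`.
  have h1 : Tendsto (fun n => ∫ x, max (g x - G n x) 0 ∂μ) atTop (𝓝 (∫ _, (0 : ℝ) ∂μ)) := by
    refine tendsto_integral_filter_of_dominated_convergence (fun x => |g x|) ?_ ?_ hg.abs ?_
    · filter_upwards [hG] with n hn
      exact ((hg.sub hn).pos_part).aestronglyMeasurable
    · filter_upwards [hGnn] with n hn
      filter_upwards [hn] with x hx
      rw [Real.norm_eq_abs, abs_of_nonneg (le_max_right _ _)]
      exact max_le (by linarith [le_abs_self (g x)]) (abs_nonneg _)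
    · filter_upwards [hlim] with x hx
      have := (tendsto_const_nhds (x := g x)).sub hx
      simpa using this.max (tendsto_const_nhds (x := (0 : ℝ)))
  have h2 : Tendsto (fun n => (∫ x, G n x ∂μ) - (∫ x, g x ∂μ) +
      2 * ∫ x, max (g x - G n x) 0 ∂μ) atTop (𝓝 0) := by
    simpa using (hint.sub_const (∫ x, g x ∂μ)).add (h1.const_mul 2)
  refine h2.congr' ?_
  filter_upwards [hG] with n hn
  have hp : Integrable (fun x => max (g x - G n x) 0) μ := (hg.sub hn).pos_part
  rw [← integral_sub hn hg, ← integral_const_mul,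
    ← integral_add (f := fun x => G n x - g x) (hn.sub hg) (hp.const_mul 2)]
  congr 1
  funext x
  rcases le_total (g x) (G n x) with h | h
  · rw [max_eq_right (by linarith), abs_of_nonneg (by linarith)]; ring
  · rw [max_eq_left (by linarith), abs_of_nonpos (by linarith)]; ring

/-- **Pratt's lemma**: dominated convergence with a converging sequence of bounds. -/
theorem tendsto_integral_of_tendsto_bound {α : Type*} [MeasurableSpace α]
    {μ : Measure α} {F : ℕ → α → ℂ} {f : α → ℂ} {G : ℕ → α → ℝ} {g : α → ℝ}
    (hFm : ∀ᶠ n in atTop, AEStronglyMeasurable (F n) μ)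
    (hbound : ∀ᶠ n in atTop, ∀ᵐ x ∂μ, ‖F n x‖ ≤ G n x)
    (hF : ∀ᵐ x ∂μ, Tendsto (fun n => F n x) atTop (𝓝 (f x)))
    (hf : Integrable f μ) (hfg : ∀ᵐ x ∂μ, ‖f x‖ ≤ g x)
    (hG : ∀ᶠ n in atTop, Integrable (G n) μ) (hg : Integrable g μ)
    (hlim : ∀ᵐ x ∂μ, Tendsto (fun n => G n x) atTop (𝓝 (g x)))
    (hint : Tendsto (fun n => ∫ x, G n x ∂μ) atTop (𝓝 (∫ x, g x ∂μ))) :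
    Tendsto (fun n => ∫ x, F n x ∂μ) atTop (𝓝 (∫ x, f x ∂μ)) := by
  have hGnn : ∀ᶠ n in atTop, ∀ᵐ x ∂μ, 0 ≤ G n x := by
    filter_upwards [hbound] with n hn
    filter_upwards [hn] with x hx using (norm_nonneg _).trans hx
  have hsch := tendsto_integral_abs_sub_of_tendsto_integral hGnn hG hg hlim hint
  -- The part of `‖F n - f‖` below `2 g` is dominated; the excess is at most `|G n - g|`, because
  -- `‖F n - f‖ ≤ G n + g`, and Scheffé's lemma sends its integral to zero.
  have h1 : Tendsto (fun n => ∫ x, min ‖F n x - f x‖ (2 * g x) ∂μ) atTop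
      (𝓝 (∫ _, (0 : ℝ) ∂μ)) := by
    refine tendsto_integral_filter_of_dominated_convergence (fun x => 2 * g x) ?_ ?_
      (hg.const_mul 2) ?_
    · filter_upwards [hFm] with n hn
      exact (hn.sub hf.1).norm.inf (hg.const_mul 2).1
    · filter_upwards with n
      filter_upwards [hfg] with x hx
      have : 0 ≤ g x := (norm_nonneg _).trans hx
      rw [Real.norm_eq_abs, abs_of_nonneg (le_min (norm_nonneg _) (by linarith))]
      exact min_le_right _ _
    · filter_upwards [hF, hfg] with x hx hx'
      have h0 : 0 ≤ g x := (norm_nonneg _).trans hx'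
      have := (tendsto_iff_norm_sub_tendsto_zero.1 hx).min
        (tendsto_const_nhds (x := 2 * g x))
      simpa [min_eq_left, h0] using this
  have h2 : Tendsto (fun n => (∫ x, min ‖F n x - f x‖ (2 * g x) ∂μ) +
      ∫ x, |G n x - g x| ∂μ) atTop (𝓝 0) := by
    simpa using h1.add hsch
  rw [tendsto_iff_norm_sub_tendsto_zero]
  refine squeeze_zero' (Eventually.of_forall fun _ => norm_nonneg _) ?_ h2
  filter_upwards [hFm, hbound, hG] with n hn hb hGn
  have hFi : Integrable (F n) μ := hGn.mono' hn hb
  have hmi : Integrable (fun x => min ‖F n x - f x‖ (2 * g x)) μ :=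
    (hFi.sub hf).norm.inf (hg.const_mul 2)
  rw [← integral_sub hFi hf, 
    ← integral_add (g := fun x => |G n x - g x|) hmi (hGn.sub hg).abs]
  refine (norm_integral_le_integral_norm _).trans
    (integral_mono_ae (hFi.sub hf).norm (hmi.add (hGn.sub hg).abs) ?_)
  filter_upwards [hb, hfg] with x hx hx'
  have h3 : ‖F n x - f x‖ ≤ G n x + g x := (norm_sub_le _ _).trans (add_le_add hx hx')
  have h4 := le_abs_self (G n x - g x)
  have h5 := abs_nonneg (G n x - g x)
  rcases le_total ‖F n x - f x‖ (2 * g x) with h | h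
  · simp only [min_eq_left h]; linarith
  · simp only [min_eq_right h]; linarith

/-- A quadratic bound valid for every `z` is wanted: with `z = Y / √n` and a factor `n` it becomes
`3 Y²`, free of `n`. The constant 3 comes from `|z| ≥ 1`, where `2 + |z| ≤ 3 z²`. -/
theorem norm_exp_ofReal_mul_I_sub_one_sub_le (z : ℝ) :
    ‖Complex.exp (z * Complex.I) - 1 - z * Complex.I‖ ≤ 3 * z ^ 2 := by
  have hz : ‖(z : ℂ) * Complex.I‖ = |z| := by simp
  rcases le_total |z| 1 with h | h
  · refine (Complex.norm_exp_sub_one_sub_id_le (by rwa [hz])).trans ?_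
    rw [hz, sq_abs]; nlinarith [sq_nonneg z]
  · have h1 := norm_sub_le (Complex.exp (z * Complex.I) - 1) (z * Complex.I)
    have h2 := norm_sub_le (Complex.exp (z * Complex.I)) 1
    rw [Complex.norm_exp_ofReal_mul_I, norm_one] at h2
    rw [hz] at h1
    nlinarith [sq_abs z]

/-- The quadratic Taylor term contributes `-y n ^ 2 / 2`, and the cubic remainder is of order `n |y
n / √n|³ = |y n|³ / √n`. -/
theorem tendsto_mul_exp_sub_one_sub {y : ℕ → ℝ} {a : ℝ} (hy : Tendsto y atTop (𝓝 a)) :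
    Tendsto (fun n : ℕ => (n : ℂ) * (Complex.exp (((√n)⁻¹ * y n : ℝ) * Complex.I) - 1 -
      ((√n)⁻¹ * y n : ℝ) * Complex.I)) atTop (𝓝 (-(a ^ 2 / 2 : ℝ))) := by
  have hs : Tendsto (fun n : ℕ => (√(n : ℝ))⁻¹) atTop (𝓝 0) :=
    tendsto_inv_atTop_zero.comp (Real.tendsto_sqrt_atTop.comp tendsto_natCast_atTop_atTop)
  have hz : Tendsto (fun n : ℕ => (√(n : ℝ))⁻¹ * y n) atTop (𝓝 0) := by simpa using hs.mul hy
  have hzc : Tendsto (fun n : ℕ => (((√n)⁻¹ * y n : ℝ) : ℂ) * Complex.I) atTop (𝓝 0) := by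
    have := (Complex.continuous_ofReal.tendsto 0).comp hz
    simpa using this.mul_const Complex.I
  have ho := (Complex.exp_sub_sum_range_isBigO_pow 3).comp_tendsto hzc
  have h1 : Tendsto (fun n : ℕ => (n : ℂ) * (Complex.exp (((√n)⁻¹ * y n : ℝ) * Complex.I) - 1 -
      ((√n)⁻¹ * y n : ℝ) * Complex.I) + (y n ^ 2 / 2 : ℝ)) atTop (𝓝 0) := by
    have h2 := (Asymptotics.isBigO_refl (fun n : ℕ => (n : ℂ)) atTop).mul ho
    have h3 : Tendsto (fun n : ℕ => (√(n : ℝ))⁻¹ * |y n| ^ 3) atTop (𝓝 0) := by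
      simpa using hs.mul (hy.abs.pow 3)
    refine ((h2.trans (k := fun n : ℕ => (√(n : ℝ))⁻¹ * |y n| ^ 3) ?_).trans_tendsto h3).congr' ?_
    · refine Asymptotics.IsBigO.of_bound 1 ?_
      filter_upwards [eventually_gt_atTop 0] with n hn
      have hn' : (0 : ℝ) < n := by exact_mod_cast hn
      have hq : (n : ℝ) = √(n : ℝ) ^ 2 := (Real.sq_sqrt hn'.le).symm
      have hq0 : 0 < √(n : ℝ) := Real.sqrt_pos.2 hn'
      simp only [Function.comp_apply, norm_mul, norm_pow, Complex.norm_natCast, Complex.norm_real,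
        Real.norm_eq_abs, Complex.norm_I, abs_inv, abs_abs,
        abs_of_pos hq0, mul_one, one_mul]
      apply le_of_eq
      nth_rewrite 1 [hq]
      field_simp
    · filter_upwards [eventually_gt_atTop 0] with n hn
      have hn' : (0 : ℝ) < n := by exact_mod_cast hn
      have hq : (n : ℂ) = (√(n : ℝ) : ℂ) ^ 2 := by
        rw [← Complex.ofReal_pow, Real.sq_sqrt hn'.le]; simp
      have hq0 : (√(n : ℝ) : ℂ) ≠ 0 := by
        exact_mod_cast (Real.sqrt_pos.2 hn').ne'
      simp only [Function.comp_apply, Finset.sum_range_succ, Finset.sum_range_zero]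
      push_cast
      rw [mul_sub, mul_sub, mul_sub, hq]
      simp only [Nat.factorial]
      push_cast
      field_simp
      have := Complex.I_sq
      ring_nf
      rw [this]; ring
  have h4 : Tendsto (fun n => (((y n) ^ 2 / 2 : ℝ) : ℂ)) atTop (𝓝 ((a ^ 2 / 2 : ℝ) : ℂ)) :=
    (Complex.continuous_ofReal.tendsto _).comp ((hy.pow 2).div_const 2)
  simpa using h1.sub h4

/-- The second order expansion of characteristic functions in a triangular array whose rows have
densities `ρ n`. -/
theorem tendsto_natCast_mul_integral_exp_sub_one {α : Type*} [MeasurableSpace α]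
    {μ : Measure α} {ρ Y : ℕ → α → ℝ} {r y : α → ℝ}
    (hρ : ∀ᶠ n in atTop, ∀ x, 0 ≤ ρ n x) (hr : ∀ x, 0 ≤ r x)
    (hρm : ∀ᶠ n in atTop, Measurable (ρ n))
    (hρi : ∀ᶠ n in atTop, Integrable (ρ n) μ)
    (hY : ∀ᶠ n in atTop, AEMeasurable (Y n) μ)
    (hYi : ∀ᶠ n in atTop, Integrable (fun x => Y n x * ρ n x) μ)
    (hY0 : ∀ᶠ n in atTop, ∫ x, Y n x * ρ n x ∂μ = 0)
    (hY2 : ∀ᶠ n in atTop, Integrable (fun x => Y n x ^ 2 * ρ n x) μ)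
    (hy2 : Integrable (fun x => y x ^ 2 * r x) μ)
    (hlim : ∀ᵐ x ∂μ, ((∀ᶠ n in atTop, ρ n x = 0) ∧ r x = 0) ∨
      (Tendsto (fun n => ρ n x) atTop (𝓝 (r x)) ∧ Tendsto (fun n => Y n x) atTop (𝓝 (y x))))
    (hvar : Tendsto (fun n => ∫ x, Y n x ^ 2 * ρ n x ∂μ) atTop
      (𝓝 (∫ x, y x ^ 2 * r x ∂μ))) :
    Tendsto (fun n : ℕ => (n : ℂ) *
      ((∫ x, Complex.exp (((√n)⁻¹ * Y n x : ℝ) * Complex.I) * (ρ n x : ℂ) ∂μ) -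
        ∫ x, (ρ n x : ℂ) ∂μ)) atTop
      (𝓝 (-((∫ x, y x ^ 2 * r x ∂μ) / 2 : ℝ))) := by
  -- The linear term may be subtracted because `Y n` is centred under `ρ n`. The integrand is then
  -- bounded by `3 (Y n)² ρ n`, which is not a fixed function but has convergent integrals by
  -- `hvar`, so Pratt's lemma applies.
  have key : Tendsto (fun n : ℕ => ∫ x, (n : ℂ) * (Complex.exp (((√n)⁻¹ * Y n x : ℝ) * Complex.I)
      - 1 - ((√n)⁻¹ * Y n x : ℝ) * Complex.I) * (ρ n x : ℂ) ∂μ) atTop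
      (𝓝 (∫ x, (-(y x ^ 2 * r x / 2) : ℝ) ∂μ : ℂ)) := by
    refine tendsto_integral_of_tendsto_bound (G := fun n x => 3 * (Y n x ^ 2 * ρ n x))
      (g := fun x => 3 * (y x ^ 2 * r x)) ?_ ?_ ?_ ?_ ?_ ?_ ?_ ?_ ?_
    · filter_upwards [hY, hρm] with n h1 h2
      apply AEMeasurable.aestronglyMeasurable
      fun_prop
    · filter_upwards [hρ, eventually_gt_atTop 0] with n h1 hn
      refine Eventually.of_forall fun x => ?_
      have hn' : (0 : ℝ) < n := by exact_mod_cast hn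
      rw [norm_mul, norm_mul, Complex.norm_natCast, Complex.norm_real, Real.norm_eq_abs,
        abs_of_nonneg (h1 x)]
      have := norm_exp_ofReal_mul_I_sub_one_sub_le ((√n)⁻¹ * Y n x)
      rw [← mul_assoc]
      refine mul_le_mul_of_nonneg_right ?_ (h1 x)
      refine (mul_le_mul_of_nonneg_left this hn'.le).trans (le_of_eq ?_)
      rw [mul_pow, inv_pow, Real.sq_sqrt hn'.le]
      field_simp
    · filter_upwards [hlim] with x hx
      rcases hx with ⟨h1, h2⟩ | ⟨h1, h2⟩
      · rw [h2]
        refine tendsto_const_nhds.congr' ?_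
        filter_upwards [h1] with n hn
        simp [hn]
      · have h3 := (tendsto_mul_exp_sub_one_sub h2).mul
          ((Complex.continuous_ofReal.tendsto _).comp h1)
        convert h3 using 2
        · simp only [Function.comp_apply]
        · push_cast; ring
    · exact (hy2.div_const 2).neg.ofReal
    · refine Eventually.of_forall fun x => ?_
      rw [Complex.norm_real, Real.norm_eq_abs, abs_neg]
      have : 0 ≤ y x ^ 2 * r x := mul_nonneg (sq_nonneg _) (hr x)
      rw [abs_of_nonneg (by linarith)]; linarith
    · filter_upwards [hY2] with n hn using hn.const_mul 3
    · exact hy2.const_mul 3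
    · filter_upwards [hlim] with x hx
      rcases hx with ⟨h1, h2⟩ | ⟨h1, h2⟩
      · rw [h2]
        refine tendsto_const_nhds.congr' ?_
        filter_upwards [h1] with n hn
        simp [hn]
      · exact ((h2.pow 2).mul h1).const_mul 3
    · simp only [integral_const_mul]
      exact hvar.const_mul 3
  rw [integral_complex_ofReal, integral_neg, integral_div, Complex.ofReal_neg] at key
  refine key.congr' ?_
  filter_upwards [hρi, hY, hYi, hY0] with n h2 h3 h4 h5
  have i1 : Integrable (fun x => (ρ n x : ℂ)) μ := h2.ofReal
  have i2 : Integrable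
      (fun x => Complex.exp (((√n)⁻¹ * Y n x : ℝ) * Complex.I) * (ρ n x : ℂ)) μ := by
    refine i1.norm.mono' ?_ (Eventually.of_forall fun x => ?_)
    · exact AEStronglyMeasurable.mul (AEMeasurable.aestronglyMeasurable (by fun_prop)) i1.1
    · rw [norm_mul, Complex.norm_exp_ofReal_mul_I, one_mul]
  have i3 : Integrable (fun x => ((Y n x * ρ n x : ℝ) : ℂ)) μ := h4.ofReal
  have i4 : Integrable (fun x => Complex.exp (((√n)⁻¹ * Y n x : ℝ) * Complex.I) * (ρ n x : ℂ) -
      (ρ n x : ℂ)) μ := i2.sub i1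
  have h6 : ∫ x, ((Y n x * ρ n x : ℝ) : ℂ) ∂μ = 0 := by
    rw [integral_complex_ofReal, h5, Complex.ofReal_zero]
  have e : ∀ x, (n : ℂ) * (Complex.exp (((√n)⁻¹ * Y n x : ℝ) * Complex.I)
      - 1 - ((√n)⁻¹ * Y n x : ℝ) * Complex.I) * (ρ n x : ℂ) =
      (n : ℂ) * (Complex.exp (((√n)⁻¹ * Y n x : ℝ) * Complex.I) * (ρ n x : ℂ) - (ρ n x : ℂ) -
        ((√n)⁻¹ : ℝ) * Complex.I * ((Y n x * ρ n x : ℝ) : ℂ)) := by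
    intro x; push_cast; ring
  simp_rw [e]
  rw [integral_const_mul, integral_sub i4 (i3.const_mul _), integral_sub i2 i1,
    integral_const_mul, h6]
  simp

/-- **Weak law of large numbers** for the product measures on `Fin n → 𝓧`. -/
theorem tendsto_pi_measure_abs_average_sub {𝓧 : Type*} [MeasurableSpace 𝓧] (ν : Measure 𝓧)
    [IsProbabilityMeasure ν] {h : 𝓧 → ℝ} (hh : Integrable h ν) {ε : ℝ} (hε : 0 < ε) :
    Tendsto (fun n : ℕ => (Measure.pi fun _ : Fin n => ν)
      {X | ε ≤ |(n : ℝ)⁻¹ * ∑ i, h (X i) - ∫ x, h x ∂ν|}) atTop (𝓝 0) := by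
  -- All sample sizes are realised on one infinite product, where the strong law holds; the law of
  -- the first `n` coordinates is the finite product.
  set Q : Measure (ℕ → 𝓧) := Measure.infinitePi fun _ => ν with hQ
  obtain ⟨g, hgm, hgh⟩ : ∃ g : 𝓧 → ℝ, Measurable g ∧ h =ᵐ[ν] g :=
    ⟨hh.1.aemeasurable.mk h, hh.1.aemeasurable.measurable_mk, hh.1.aemeasurable.ae_eq_mk⟩
  have hgi : Integrable g ν := hh.congr hgh
  have mp : ∀ i : ℕ, MeasurePreserving (Function.eval i) Q ν :=
    fun i => measurePreserving_eval_infinitePi _ i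
  have hslln := strong_law_ae_real (μ := Q) (fun i ω => g (ω i))
    ((mp 0).integrable_comp_of_integrable hgi)
    (fun i j hij => (iIndepFun_infinitePi (P := fun _ : ℕ => ν) (X := fun _ => g)
      fun _ => hgm).indepFun hij)
    (fun i => ⟨(hgm.comp (mp i).measurable).aemeasurable,
      (hgm.comp (mp 0).measurable).aemeasurable, by
      change Measure.map (g ∘ Function.eval i) Q = Measure.map (g ∘ Function.eval 0) Q
      rw [← Measure.map_map hgm (mp i).measurable, ← Measure.map_map hgm (mp 0).measurable,
        (mp i).map_eq, (mp 0).map_eq]⟩)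
  have hE : ∫ ω, g (ω 0) ∂Q = ∫ x, h x ∂ν := by
    rw [integral_congr_ae hgh, ← (mp 0).map_eq,
      integral_map (mp 0).measurable.aemeasurable hgm.aestronglyMeasurable]
  simp only [hE] at hslln
  have hm := tendstoInMeasure_of_tendsto_ae (μ := Q)
    (fun n => Measurable.aestronglyMeasurable (by fun_prop)) hslln
  rw [tendstoInMeasure_iff_norm] at hm
  refine (hm ε hε).congr fun n => ?_
  have hmap : Measure.pi (fun _ : Fin n => ν) = Q.map fun ω (i : Fin n) => ω i := by
    rw [Measure.map_infinitePi_infinitePi_of_inj (f := fun i : Fin n => (i : ℕ))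
      Fin.val_injective, Measure.infinitePi_eq_pi]
  have hae : ∀ᵐ X ∂(Measure.pi fun _ : Fin n => ν), ∀ i, h (X i) = g (X i) :=
    ae_all_iff.2 fun i => (Measure.quasiMeasurePreserving_eval (fun _ : Fin n => ν) i).ae hgh
  have : (Measure.pi fun _ : Fin n => ν)
      {X | ε ≤ |(n : ℝ)⁻¹ * ∑ i, h (X i) - ∫ x, h x ∂ν|} = (Measure.pi fun _ : Fin n => ν)
      {X | ε ≤ |(n : ℝ)⁻¹ * ∑ i, g (X i) - ∫ x, h x ∂ν|} := by
    refine measure_congr ?_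
    filter_upwards [hae] with X hX
    simp only [eq_iff_iff]
    change (ε ≤ _) ↔ (ε ≤ _)
    simp only [hX]
  rw [this, hmap, Measure.map_apply (by fun_prop) (measurableSet_le (by fun_prop) (by fun_prop))]
  congr 1
  ext ω
  simp only [Set.mem_ofPred_eq, Set.preimage_ofPred_eq, Real.norm_eq_abs]
  rw [← Finset.sum_range (fun i => g (ω i)), inv_mul_eq_div]

/-- In the definition of contiguity, the sets need not be measurable. -/
theorem Contiguous.tendsto_zero {S : ℕ → Type*} [∀ n, MeasurableSpace (S n)]
    {Q P : ∀ n, Measure (S n)} (h : Contiguous Q P) {A : ∀ n, Set (S n)}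
    (hA : Tendsto (fun n => P n (A n)) atTop (𝓝 0)) :
    Tendsto (fun n => Q n (A n)) atTop (𝓝 0) := by
  have := h (fun n => toMeasurable (P n) (A n)) (fun n => measurableSet_toMeasurable _ _)
    (by simpa only [measure_toMeasurable] using hA)
  exact tendsto_of_tendsto_of_tendsto_of_le_of_le tendsto_const_nhds this (fun _ => zero_le)
    fun n => measure_mono (subset_toMeasurable _ _)

theorem norm_exp_ofReal_mul_I_sub_le (a b : ℝ) :
    ‖Complex.exp (a * Complex.I) - Complex.exp (b * Complex.I)‖ ≤ |a - b| := by
  have h := Real.norm_exp_I_mul_ofReal_sub_one_le (x := a - b)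
  have e : Complex.exp (a * Complex.I) - Complex.exp (b * Complex.I) =
      Complex.exp (b * Complex.I) * (Complex.exp (Complex.I * (a - b : ℝ)) - 1) := by
    rw [mul_sub, ← Complex.exp_add, mul_one]
    congr 2
    push_cast; ring
  rw [e, norm_mul, Complex.norm_exp_ofReal_mul_I, one_mul]
  exact h

/-- **Slutsky's theorem** in terms of characteristic functions at `1`. -/
theorem tendsto_integral_exp_of_sub_tendsto {S : ℕ → Type*} [∀ n, MeasurableSpace (S n)]
    {P : ∀ n, Measure (S n)} [∀ n, IsProbabilityMeasure (P n)] {A B : ∀ n, S n → ℝ}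
    (hA : ∀ᶠ n in atTop, AEMeasurable (A n) (P n)) (hB : ∀ᶠ n in atTop, AEMeasurable (B n) (P n))
    {c : ℝ} (h : ∀ ε > 0, Tendsto (fun n => P n {X | ε ≤ |B n X - A n X - c|}) atTop (𝓝 0)) {L : ℂ}
    (hL : Tendsto (fun n => ∫ X, Complex.exp (A n X * Complex.I) ∂P n) atTop (𝓝 L)) :
    Tendsto (fun n => ∫ X, Complex.exp (B n X * Complex.I) ∂P n) atTop
      (𝓝 (Complex.exp (c * Complex.I) * L)) := by
  have key : Tendsto (fun n => (∫ X, Complex.exp (B n X * Complex.I) ∂P n) -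
      Complex.exp (c * Complex.I) * ∫ X, Complex.exp (A n X * Complex.I) ∂P n) atTop (𝓝 0) := by
    rw [Metric.tendsto_atTop']
    intro ε hε
    -- Off the exceptional event the exponentials differ by at most `ε / 4`; on it by at most 2,
    -- with probability below `ε / 4`. The total is at most `3 ε / 4`.
    have h1 := h (ε / 4) (by positivity)
    have h2 : ∀ᶠ n in atTop, P n {X | ε / 4 ≤ |B n X - A n X - c|} < ENNReal.ofReal (ε / 4) :=
      h1.eventually_lt_const (by simpa using hε)
    obtain ⟨N, hN⟩ := eventually_atTop.1 (h2.and (hA.and hB))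
    refine ⟨N, fun n hn => ?_⟩
    obtain ⟨hn2, hAn, hBn⟩ := hN n hn.le
    set E := {X | ε / 4 ≤ |B n X - A n X - c|} with hE
    -- `A` and `B` are only almost everywhere measurable, so the event is replaced by a measurable
    -- hull of equal probability.
    set E' := toMeasurable (P n) E
    have hEr : (P n).real E' < ε / 4 := by
      rw [measureReal_def, measure_toMeasurable]
      exact ENNReal.toReal_lt_of_lt_ofReal hn2
    have i1 : ∀ {D : S n → ℝ}, AEMeasurable D (P n) →
        Integrable (fun X => Complex.exp (D X * Complex.I)) (P n) := fun hD =>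
      (integrable_const (1 : ℝ)).mono' (AEMeasurable.aestronglyMeasurable (by fun_prop))
        (Eventually.of_forall fun X => by rw [Complex.norm_exp_ofReal_mul_I])
    rw [dist_zero_right, ← integral_const_mul, ← integral_sub (i1 hBn) ((i1 hAn).const_mul _)]
    have i2 : Integrable (fun X => ε / 4 + E'.indicator (fun _ => (2 : ℝ)) X) (P n) :=
      (integrable_const _).add
        ((integrable_const _).indicator (measurableSet_toMeasurable _ _))
    refine (norm_integral_le_of_norm_le i2 (Eventually.of_forall fun X => ?_)).trans_lt ?_
    · have e : Complex.exp (c * Complex.I) * Complex.exp (A n X * Complex.I) =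
          Complex.exp ((A n X + c : ℝ) * Complex.I) := by
        rw [← Complex.exp_add]; congr 1; push_cast; ring
      rw [e]
      by_cases hX : X ∈ E'
      · rw [Set.indicator_of_mem hX]
        refine (norm_sub_le _ _).trans ?_
        rw [Complex.norm_exp_ofReal_mul_I, Complex.norm_exp_ofReal_mul_I]
        linarith
      · rw [Set.indicator_of_notMem hX, add_zero]
        have hX' : ¬ (ε / 4 ≤ |B n X - A n X - c|) := fun hX' =>
          hX (subset_toMeasurable _ _ hX')
        refine (norm_exp_ofReal_mul_I_sub_le _ _).trans ?_
        rw [← sub_sub]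
        exact (not_le.1 hX').le
    · rw [integral_add (integrable_const _)
        ((integrable_const _).indicator (measurableSet_toMeasurable _ _)),
        integral_indicator_const _ (measurableSet_toMeasurable _ _)]
      simp only [integral_const, probReal_univ, smul_eq_mul, one_mul]
      linarith
  simpa using key.add (hL.const_mul (Complex.exp (c * Complex.I)))

end GeneralProbability

/-! ### Taylor expansion without continuity of the third derivative. -/

section Calculus

variable {E : Type*} [NormedAddCommGroup E] [NormedSpace ℝ E]

theorem iteratedFDeriv_two_apply_eq_fderiv {F : E → ℝ} {θ : E}
    (hF : DifferentiableAt ℝ (fderiv ℝ F) θ) (v w : E) :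
    iteratedFDeriv ℝ 2 F θ ![v, w] = fderiv ℝ (fun t => fderiv ℝ F t w) θ v := by
  rw [iteratedFDeriv_two_apply, fderiv_clm_apply hF (differentiableAt_const w)]
  simp

/-- The integral of a power of the density is only assumed three times differentiable. Its third
derivative may be discontinuous, so `C²` is what remains available. -/
theorem contDiffOn_two_of_differentiableAt_iteratedFDeriv {F : E → ℝ} {Ω : Set E} (hΩ : IsOpen Ω)
    (hF : ∀ k < 3, ∀ θ ∈ Ω, DifferentiableAt ℝ (iteratedFDeriv ℝ k F) θ) :
    ContDiffOn ℝ 2 F Ω := by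
  refine contDiffOn_of_differentiableOn (n := 2) fun m hm θ hθ => ?_
  have hm' : m < 3 := by
    have : m ≤ 2 := by exact_mod_cast hm
    omega
  exact ((hF m hm' θ hθ).differentiableWithinAt).congr
    (fun t ht => iteratedFDerivWithin_of_isOpen m hΩ ht) (iteratedFDerivWithin_of_isOpen m hΩ hθ)

theorem differentiableAt_iteratedFDeriv_of_contDiffOn {F : E → ℝ} {Ω : Set E} (hΩ : IsOpen Ω)
    (hF : ContDiffOn ℝ 3 F Ω) {k : ℕ} (hk : k < 3) {θ : E} (hθ : θ ∈ Ω) :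
    DifferentiableAt ℝ (iteratedFDeriv ℝ k F) θ :=
  (hF.contDiffAt (hΩ.mem_nhds hθ)).differentiableAt_iteratedFDeriv (by exact_mod_cast hk)

/-- Serves the loss, the sum of an integral term that need not be `C³` and a `C³` term in the
density at one point. -/
theorem differentiableAt_iteratedFDeriv_add {A B : E → ℝ} {Ω : Set E} (hΩ : IsOpen Ω)
    (hA : ∀ k < 3, ∀ θ ∈ Ω, DifferentiableAt ℝ (iteratedFDeriv ℝ k A) θ)
    (hB : ContDiffOn ℝ 3 B Ω) :
    ∀ k < 3, ∀ θ ∈ Ω, DifferentiableAt ℝ (iteratedFDeriv ℝ k (A + B)) θ := by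
  intro k hk θ hθ
  have hA2 := contDiffOn_two_of_differentiableAt_iteratedFDeriv hΩ hA
  refine ((hA k hk θ hθ).add
    (differentiableAt_iteratedFDeriv_of_contDiffOn hΩ hB hk hθ)).congr_of_eventuallyEq ?_
  filter_upwards [hΩ.mem_nhds hθ] with t ht
  have hk2 : ((k : ℕ) : WithTop ℕ∞) ≤ 2 := by
    have : k ≤ 2 := by omega
    exact_mod_cast this
  have hk3 : ((k : ℕ) : WithTop ℕ∞) ≤ 3 := by
    have : k ≤ 3 := by omega
    exact_mod_cast this
  exact iteratedFDeriv_add_apply ((hA2.contDiffAt (hΩ.mem_nhds ht)).of_le hk2)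
    ((hB.contDiffAt (hΩ.mem_nhds ht)).of_le hk3)

/-- First order Taylor expansion of the derivative along a segment. -/
theorem abs_fderiv_add_smul_sub_le {F : E → ℝ} {Ω : Set E}
    (hF : ∀ k < 3, ∀ θ ∈ Ω, DifferentiableAt ℝ (iteratedFDeriv ℝ k F) θ) {θ d v : E} {C h : ℝ}
    (hh : 0 ≤ h) (hseg : ∀ s ∈ Set.Icc 0 h, θ + s • d ∈ Ω)
    (hC : ∀ t ∈ Ω, |iteratedFDeriv ℝ 3 F t ![d, d, v]| ≤ C) :
    |fderiv ℝ F (θ + h • d) v - fderiv ℝ F θ v - h * iteratedFDeriv ℝ 2 F θ ![d, v]| ≤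
      C * h ^ 2 := by
  have hline : ∀ s : ℝ, HasDerivAt (fun s : ℝ => θ + s • d) d s := fun s => by
    simpa using ((hasDerivAt_id s).smul_const d).const_add θ
  have hder : ∀ k < 3, ∀ m : Fin k → E, ∀ s ∈ Set.Icc 0 h,
      HasDerivAt (fun s : ℝ => iteratedFDeriv ℝ k F (θ + s • d) m)
        (iteratedFDeriv ℝ (k + 1) F (θ + s • d) (Fin.cons d m)) s := by
    intro k hk m s hs
    have h1 := (hF k hk _ (hseg s hs)).hasFDerivAt.comp_hasDerivAt s (hline s)
    have h2 := (ContinuousMultilinearMap.apply ℝ (fun _ : Fin k => E) ℝ m).hasFDerivAt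
      |>.comp_hasDerivAt s h1
    rw [iteratedFDeriv_succ_apply_left, Fin.cons_zero, Fin.tail_cons]
    exact h2
  have hC0 : 0 ≤ C := (abs_nonneg _).trans (hC _ (hseg 0 ⟨le_rfl, hh⟩))
  have hf0 : (Fin.cons d ![d, v] : Fin 3 → E) = ![d, d, v] := rfl
  have hf1 : (Fin.cons d ![v] : Fin 2 → E) = ![d, v] := rfl
  -- The mean value inequality is used twice: the second derivative moves by at most `C h`, hence
  -- the first derivative minus its linear part moves by at most `C h · h`. The sharp factor `1 / 2`
  -- is not needed.
  have step1 : ∀ s ∈ Set.Icc 0 h, |iteratedFDeriv ℝ 2 F (θ + s • d) ![d, v] -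
      iteratedFDeriv ℝ 2 F θ ![d, v]| ≤ C * h := by
    intro s hs
    have := (convex_Icc (0 : ℝ) h).norm_image_sub_le_of_norm_hasDerivWithin_le
      (f := fun s : ℝ => iteratedFDeriv ℝ 2 F (θ + s • d) ![d, v]) (C := C)
      (fun x hx => (hder 2 (by norm_num) ![d, v] x hx).hasDerivWithinAt)
      (fun x hx => by rw [hf0]; exact hC _ (hseg x hx)) ⟨le_rfl, hh⟩ hs
    simp only [zero_smul, add_zero, sub_zero, Real.norm_eq_abs] at this
    refine this.trans (mul_le_mul_of_nonneg_left ?_ hC0)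
    rw [abs_of_nonneg hs.1]; exact hs.2
  have step2 := (convex_Icc (0 : ℝ) h).norm_image_sub_le_of_norm_hasDerivWithin_le
      (f := fun s : ℝ => iteratedFDeriv ℝ 1 F (θ + s • d) ![v] -
        s * iteratedFDeriv ℝ 2 F θ ![d, v]) (C := C * h)
      (fun x hx => ((hder 1 (by norm_num) ![v] x hx).sub
        ((hasDerivAt_id x).mul_const (iteratedFDeriv ℝ 2 F θ ![d, v]))).hasDerivWithinAt)
      (fun x hx => by
        rw [hf1, one_mul]
        exact step1 x hx) (Set.left_mem_Icc.2 hh) (Set.right_mem_Icc.2 hh)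
  simp only [zero_smul, add_zero, sub_zero, Real.norm_eq_abs, iteratedFDeriv_one_apply,
    zero_mul, abs_of_nonneg hh, Matrix.cons_val_zero] at step2
  calc _ = _ := by congr 1; ring
    _ ≤ _ := step2
    _ = _ := by ring

end Calculus

/-- A trilinear form is bounded through its values at the basis vectors. -/
theorem abs_trilinear_le_sum {p : ℕ}
    (A : ContinuousMultilinearMap ℝ (fun _ : Fin 3 => EuclideanSpace ℝ (Fin p)) ℝ)
    (a b c : EuclideanSpace ℝ (Fin p)) {ζ : Fin p → Fin p → Fin p → ℝ}
    (hζ : ∀ j k l, |A ![EuclideanSpace.single j 1, EuclideanSpace.single k 1,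
      EuclideanSpace.single l 1]| ≤ ζ j k l) :
    |A ![a, b, c]| ≤ ∑ r : Fin 3 → Fin p,
      (∏ i, |(![a, b, c] i : EuclideanSpace ℝ (Fin p)) (r i)|) * ζ (r 0) (r 1) (r 2) := by
  have hexp : ![a, b, c] = fun i : Fin 3 => ∑ j : Fin p,
      (![a, b, c] i : EuclideanSpace ℝ (Fin p)) j • EuclideanSpace.single j (1 : ℝ) := by
    funext i
    ext k
    simp [Pi.single_apply]
  conv_lhs => rw [hexp, ContinuousMultilinearMap.map_sum]
  refine (Finset.abs_sum_le_sum_abs _ _).trans (Finset.sum_le_sum fun r _ => ?_)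
  rw [ContinuousMultilinearMap.map_smul_univ, smul_eq_mul, abs_mul, Finset.abs_prod]
  refine mul_le_mul_of_nonneg_left ?_ (Finset.prod_nonneg fun _ _ => abs_nonneg _)
  refine le_of_eq_of_le ?_ (hζ (r 0) (r 1) (r 2))
  congr 2
  funext i
  fin_cases i <;> rfl

/-! ### Scores in a fixed direction and expectations under the model. -/

namespace DensityModel

variable {𝓧 : Type*} [MeasurableSpace 𝓧] {μ : Measure 𝓧} {p : ℕ} {M : DensityModel μ p}

theorem inner_score (θ v : EuclideanSpace ℝ (Fin p)) (x : 𝓧) :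
    inner ℝ (M.score θ x) v = fderiv ℝ (fun t => Real.log (M.f t x)) θ v := by
  rw [score, gradient, InnerProductSpace.toDual_symm_apply]

theorem inner_score_eq_sum (θ v : EuclideanSpace ℝ (Fin p)) (x : 𝓧) :
    inner ℝ (M.score θ x) v = ∑ i, M.score θ x i * v i := by
  rw [PiLp.inner_apply]
  simp [mul_comm]

theorem u_dotProduct (β : ℝ) (θ v : EuclideanSpace ℝ (Fin p)) (x : 𝓧) :
    M.u β x θ ⬝ᵥ v = inner ℝ (M.score θ x) v * M.f θ x ^ β - M.xi β θ ⬝ᵥ v := by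
  rw [inner_score_eq_sum, dotProduct, dotProduct, Finset.sum_mul, ← Finset.sum_sub_distrib]
  refine Finset.sum_congr rfl fun i _ => ?_
  simp only [u]; ring

theorem integrable_f {θ : EuclideanSpace ℝ (Fin p)} (hθ : θ ∈ M.Θ) : Integrable (M.f θ) μ := by
  refine ⟨(M.measurable_f θ hθ).aestronglyMeasurable, ?_⟩
  rw [hasFiniteIntegral_iff_ofReal (Eventually.of_forall (M.f_nonneg θ hθ)), M.lintegral_f θ hθ]
  exact ENNReal.one_lt_top

theorem integral_f {θ : EuclideanSpace ℝ (Fin p)} (hθ : θ ∈ M.Θ) : ∫ x, M.f θ x ∂μ = 1 := by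
  rw [integral_eq_lintegral_of_nonneg_ae (Eventually.of_forall (M.f_nonneg θ hθ))
    (M.measurable_f θ hθ).aestronglyMeasurable, M.lintegral_f θ hθ, ENNReal.toReal_one]

theorem integrable_law_iff (θ : M.Θ) {g : 𝓧 → ℝ} :
    Integrable g (M.law θ) ↔ Integrable (fun x => g x * M.f θ x) μ := by
  rw [law, integrable_withDensity_iff (M.measurable_f θ θ.2).ennreal_ofReal (by simp)]
  simp only [ENNReal.toReal_ofReal (M.f_nonneg θ θ.2 _)]

theorem integral_law (θ : M.Θ) {F : Type*} [NormedAddCommGroup F] [NormedSpace ℝ F] (g : 𝓧 → F) :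
    ∫ x, g x ∂M.law θ = ∫ x, M.f θ x • g x ∂μ := by
  rw [law, integral_withDensity_eq_integral_toReal_smul₀
    (M.measurable_f θ θ.2).ennreal_ofReal.aemeasurable (by simp)]
  simp only [ENNReal.toReal_ofReal (M.f_nonneg θ θ.2 _)]

end DensityModel

/-! ### Common support and pointwise derivatives of powers of the density. -/

namespace BasuConditions

open DensityModel

variable {𝓧 : Type*} [MeasurableSpace 𝓧] {μ : Measure 𝓧} {p : ℕ} {M : DensityModel μ p} {β : ℝ}
  {θ₀ : EuclideanSpace ℝ (Fin p)} {Ω : Set (EuclideanSpace ℝ (Fin p))}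

theorem f_pos_iff (h : BasuConditions M β θ₀ Ω) {θ : EuclideanSpace ℝ (Fin p)} (hθ : θ ∈ M.Θ)
    (x : 𝓧) : 0 < M.f θ x ↔ 0 < M.f θ₀ x := Set.ext_iff.1 (h.support_eq θ hθ) x

theorem f_eq_zero (h : BasuConditions M β θ₀ Ω) {θ : EuclideanSpace ℝ (Fin p)} (hθ : θ ∈ M.Θ)
    {x : 𝓧} (hx : ¬ 0 < M.f θ₀ x) : M.f θ x = 0 :=
  le_antisymm (not_lt.1 fun h' => hx ((h.f_pos_iff hθ x).1 h')) (M.f_nonneg θ hθ x)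

theorem f_eventuallyEq_zero (h : BasuConditions M β θ₀ Ω) {θ : EuclideanSpace ℝ (Fin p)}
    (hθ : θ ∈ Ω) {x : 𝓧} (hx : ¬ 0 < M.f θ₀ x) : (fun t => M.f t x) =ᶠ[𝓝 θ] fun _ => 0 := by
  filter_upwards [h.isOpen.mem_nhds hθ] with t ht using h.f_eq_zero (h.subset ht) hx

/-- Off the common support `log f` is locally the constant `log 0 = 0`. Integrals of score terms can
therefore run over all of `𝓧`. -/
theorem score_eq_zero (h : BasuConditions M β θ₀ Ω) {θ : EuclideanSpace ℝ (Fin p)}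
    (hθ : θ ∈ Ω) {x : 𝓧} (hx : ¬ 0 < M.f θ₀ x) : M.score θ x = 0 := by
  have : (fun t => Real.log (M.f t x)) =ᶠ[𝓝 θ] fun _ => 0 := by
    filter_upwards [h.f_eventuallyEq_zero hθ hx] with t ht
    rw [ht, Real.log_zero]
  rw [score, gradient, this.fderiv_eq]
  simp

theorem f_pos (h : BasuConditions M β θ₀ Ω) {θ : EuclideanSpace ℝ (Fin p)} (hθ : θ ∈ Ω)
    {x : 𝓧} (hx : 0 < M.f θ₀ x) : 0 < M.f θ x := (h.f_pos_iff (h.subset hθ) x).2 hx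

section Pointwise

variable {x : 𝓧} {θ : EuclideanSpace ℝ (Fin p)}

theorem contDiffOn_log (h : BasuConditions M β θ₀ Ω) (hx : 0 < M.f θ₀ x)
    (hc : ContDiffOn ℝ 3 (fun t => M.f t x) Ω) :
    ContDiffOn ℝ 3 (fun t => Real.log (M.f t x)) Ω :=
  hc.log fun _ ht => (h.f_pos ht hx).ne'

theorem contDiffOn_rpow (h : BasuConditions M β θ₀ Ω) (hx : 0 < M.f θ₀ x)
    (hc : ContDiffOn ℝ 3 (fun t => M.f t x) Ω) (a : ℝ) :
    ContDiffOn ℝ 3 (fun t => M.f t x ^ a) Ω :=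
  hc.rpow_const_of_ne fun _ ht => (h.f_pos ht hx).ne'

theorem fderiv_rpow (h : BasuConditions M β θ₀ Ω) (hx : 0 < M.f θ₀ x)
    (hc : ContDiffOn ℝ 3 (fun t => M.f t x) Ω) (hθ : θ ∈ Ω) (a : ℝ)
    (v : EuclideanSpace ℝ (Fin p)) :
    fderiv ℝ (fun t => M.f t x ^ a) θ v = a * (M.f θ x ^ a * inner ℝ (M.score θ x) v) := by
  have hpos := h.f_pos hθ hx
  have hd := ((hc.contDiffAt (h.isOpen.mem_nhds hθ)).differentiableAt (by norm_num)).hasFDerivAt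
  rw [inner_score, (hd.rpow_const (p := a) (Or.inl hpos.ne')).fderiv, (hd.log hpos.ne').fderiv,
    Real.rpow_sub_one hpos.ne']
  simp only [smul_apply, smul_eq_mul]
  ring

theorem differentiableAt_inner_score (h : BasuConditions M β θ₀ Ω) (hx : 0 < M.f θ₀ x)
    (hc : ContDiffOn ℝ 3 (fun t => M.f t x) Ω) (hθ : θ ∈ Ω) (v : EuclideanSpace ℝ (Fin p)) :
    DifferentiableAt ℝ (fun t => inner ℝ (M.score t x) v) θ := by
  simp only [inner_score]
  have h1 : ContDiffAt ℝ 2 (fderiv ℝ fun t => Real.log (M.f t x)) θ :=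
    ((h.contDiffOn_log hx hc).contDiffAt (h.isOpen.mem_nhds hθ)).fderiv_right (by norm_num)
  exact (h1.differentiableAt (by norm_num)).clm_apply (differentiableAt_const v)

theorem differentiableAt_f_rpow (h : BasuConditions M β θ₀ Ω) (hx : 0 < M.f θ₀ x)
    (hc : ContDiffOn ℝ 3 (fun t => M.f t x) Ω) (hθ : θ ∈ Ω) (a : ℝ) :
    DifferentiableAt ℝ (fun t => M.f t x ^ a) θ :=
  ((h.contDiffOn_rpow hx hc a).contDiffAt (h.isOpen.mem_nhds hθ)).differentiableAt (by norm_num)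

theorem fderiv_rpow_mul_inner_score (h : BasuConditions M β θ₀ Ω) (hx : 0 < M.f θ₀ x)
    (hc : ContDiffOn ℝ 3 (fun t => M.f t x) Ω) (hθ : θ ∈ Ω) (a : ℝ)
    (d v : EuclideanSpace ℝ (Fin p)) :
    fderiv ℝ (fun t => M.f t x ^ a * inner ℝ (M.score t x) v) θ d =
      M.f θ x ^ a * (a * (inner ℝ (M.score θ x) d * inner ℝ (M.score θ x) v) +
        fderiv ℝ (fun t => inner ℝ (M.score t x) v) θ d) := by
  rw [fderiv_fun_mul (h.differentiableAt_f_rpow hx hc hθ a)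
    (h.differentiableAt_inner_score hx hc hθ v)]
  simp only [add_apply, smul_apply, smul_eq_mul,
    h.fderiv_rpow hx hc hθ]
  ring

/-- The exponent enters the bracket only as the coefficient of the product of scores. Comparing `a =
β` with `a = β + 1` leaves exactly the integrand of `J`. -/
theorem iteratedFDeriv_two_rpow (h : BasuConditions M β θ₀ Ω) (hx : 0 < M.f θ₀ x)
    (hc : ContDiffOn ℝ 3 (fun t => M.f t x) Ω) (hθ : θ ∈ Ω) (a : ℝ)
    (d v : EuclideanSpace ℝ (Fin p)) :
    iteratedFDeriv ℝ 2 (fun t => M.f t x ^ a) θ ![d, v] =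
      a * (M.f θ x ^ a * (a * (inner ℝ (M.score θ x) d * inner ℝ (M.score θ x) v) +
        fderiv ℝ (fun t => inner ℝ (M.score t x) v) θ d)) := by
  have h1 : ContDiffAt ℝ 2 (fderiv ℝ fun t => M.f t x ^ a) θ :=
    ((h.contDiffOn_rpow hx hc a).contDiffAt (h.isOpen.mem_nhds hθ)).fderiv_right (by norm_num)
  rw [iteratedFDeriv_two_apply_eq_fderiv (h1.differentiableAt (by norm_num))]
  have h2 : (fun t => fderiv ℝ (fun t => M.f t x ^ a) t v) =ᶠ[𝓝 θ]
      fun t => a * (M.f t x ^ a * inner ℝ (M.score t x) v) := by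
    filter_upwards [h.isOpen.mem_nhds hθ] with t ht using h.fderiv_rpow hx hc ht a v
  rw [h2.fderiv_eq, fderiv_const_mul ((h.differentiableAt_f_rpow hx hc hθ a).fun_mul
    (h.differentiableAt_inner_score hx hc hθ v)), smul_apply,
    h.fderiv_rpow_mul_inner_score hx hc hθ, smul_eq_mul]

end Pointwise

end BasuConditions

/-- Products of measurable functions are integrable if the squares are. -/
theorem integrable_mul_mul_of_integrable_sq {α : Type*} [MeasurableSpace α] {μ : Measure α}
    {a b w : α → ℝ} (ha : AEMeasurable a μ) (hb : AEMeasurable b μ) (hwm : AEMeasurable w μ)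
    (hw : ∀ x, 0 ≤ w x) (ha2 : Integrable (fun x => a x * a x * w x) μ)
    (hb2 : Integrable (fun x => b x * b x * w x) μ) :
    Integrable (fun x => a x * b x * w x) μ := by
  refine (ha2.add hb2).mono' (AEMeasurable.aestronglyMeasurable (by fun_prop))
    (Eventually.of_forall fun x => ?_)
  rw [Real.norm_eq_abs, abs_mul, abs_of_nonneg (hw x), Pi.add_apply, ← add_mul]
  refine mul_le_mul_of_nonneg_right (abs_le.2 ⟨?_, ?_⟩) (hw x)
  · nlinarith [sq_nonneg (a x + b x), mul_self_nonneg (a x), mul_self_nonneg (b x)]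
  · nlinarith [sq_nonneg (a x - b x), mul_self_nonneg (a x), mul_self_nonneg (b x)]

namespace DensityModel

variable {𝓧 : Type*} [MeasurableSpace 𝓧] {μ : Measure 𝓧} {p : ℕ} {M : DensityModel μ p}

/-- The quadratic form of a matrix of integrals of products of the coordinates of the score. -/
theorem integral_inner_score_mul_inner_score {θ : EuclideanSpace ℝ (Fin p)} {w : 𝓧 → ℝ}
    (hi : ∀ i j, Integrable (fun x => M.score θ x i * M.score θ x j * w x) μ)
    (d v : EuclideanSpace ℝ (Fin p)) :
    Integrable (fun x => inner ℝ (M.score θ x) d * inner ℝ (M.score θ x) v * w x) μ ∧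
    ∫ x, inner ℝ (M.score θ x) d * inner ℝ (M.score θ x) v * w x ∂μ =
      d ⬝ᵥ (Matrix.of fun i j => ∫ x, M.score θ x i * M.score θ x j * w x ∂μ).mulVec v := by
  have e : (fun x => inner ℝ (M.score θ x) d * inner ℝ (M.score θ x) v * w x) =
      fun x => ∑ i, ∑ j, d i * v j * (M.score θ x i * M.score θ x j * w x) := by
    funext x
    rw [inner_score_eq_sum, inner_score_eq_sum, Finset.sum_mul_sum, Finset.sum_mul]
    refine Finset.sum_congr rfl fun i _ => ?_
    rw [Finset.sum_mul]
    exact Finset.sum_congr rfl fun j _ => by ring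
  rw [e]
  have hij : ∀ i j, Integrable
      (fun x => d i * v j * (M.score θ x i * M.score θ x j * w x)) μ :=
    fun i j => (hi i j).const_mul _
  refine ⟨integrable_finsetSum _ fun i _ => integrable_finsetSum _ fun j _ => hij i j, ?_⟩
  rw [integral_finsetSum _ fun i _ => integrable_finsetSum _ fun j _ => hij i j]
  simp only [dotProduct, Matrix.mulVec, Matrix.of_apply, Finset.mul_sum]
  refine Finset.sum_congr rfl fun i _ => ?_
  rw [integral_finsetSum _ fun j _ => hij i j]
  refine Finset.sum_congr rfl fun j _ => ?_
  rw [integral_const_mul]; ring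

end DensityModel

/-! ### First and second moments of the score. -/

namespace BasuConditions

open DensityModel

variable {𝓧 : Type*} [MeasurableSpace 𝓧] {μ : Measure 𝓧} {p : ℕ} {M : DensityModel μ p} {β : ℝ}
  {θ₀ : EuclideanSpace ℝ (Fin p)} {Ω : Set (EuclideanSpace ℝ (Fin p))}
  {θ : EuclideanSpace ℝ (Fin p)}

theorem iteratedFDeriv_one_rpow_ae (h : BasuConditions M β θ₀ Ω) (hβ : 0 ≤ β) (hθ : θ ∈ Ω)
    (v : EuclideanSpace ℝ (Fin p)) :
    (fun x => iteratedFDeriv ℝ 1 (fun t => M.f t x ^ (β + 1)) θ ![v]) =ᵐ[μ]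
      fun x => (β + 1) * (inner ℝ (M.score θ x) v * M.f θ x ^ (β + 1)) := by
  filter_upwards [h.contDiffOn] with x hc
  by_cases hx : 0 < M.f θ₀ x
  · rw [iteratedFDeriv_one_apply, Matrix.cons_val_zero, h.fderiv_rpow hx (hc hx) hθ]
    ring
  · have e : (fun t => M.f t x ^ (β + 1)) =ᶠ[𝓝 θ] fun _ => 0 := by
      filter_upwards [h.f_eventuallyEq_zero hθ hx] with t ht
      rw [ht, Real.zero_rpow (by linarith)]
    rw [iteratedFDeriv_one_apply, e.fderiv_eq, h.score_eq_zero hθ hx]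
    simp

/-- Up to the factor `β + 1` this function is the first derivative of `f ^ (β + 1)`, which is
integrable by differentiation under the integral sign. -/
theorem integrable_inner_score_mul (h : BasuConditions M β θ₀ Ω) (hβ : 0 ≤ β) (hθ : θ ∈ Ω)
    (v : EuclideanSpace ℝ (Fin p)) :
    Integrable (fun x => inner ℝ (M.score θ x) v * M.f θ x ^ (β + 1)) μ := by
  have h1 := ((h.diff_integral.integrable 1 (by norm_num) θ hθ ![v]).congr
    (h.iteratedFDeriv_one_rpow_ae hβ hθ v)).const_mul (β + 1)⁻¹
  refine h1.congr (Eventually.of_forall fun x => ?_)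
  have : β + 1 ≠ 0 := by linarith
  simp only
  field_simp

theorem xi_dotProduct (h : BasuConditions M β θ₀ Ω) (hβ : 0 ≤ β) (hθ : θ ∈ Ω)
    (v : EuclideanSpace ℝ (Fin p)) :
    M.xi β θ ⬝ᵥ v = ∫ x, inner ℝ (M.score θ x) v * M.f θ x ^ (β + 1) ∂μ := by
  have hi : ∀ i, Integrable (fun x => M.score θ x i * M.f θ x ^ (β + 1)) μ := fun i => by
    simpa [EuclideanSpace.inner_single_right] using
      h.integrable_inner_score_mul hβ hθ (EuclideanSpace.single i 1)
  have e : (fun x => inner ℝ (M.score θ x) v * M.f θ x ^ (β + 1)) =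
      fun x => ∑ i, v i * (M.score θ x i * M.f θ x ^ (β + 1)) := by
    funext x
    rw [inner_score_eq_sum, Finset.sum_mul]
    exact Finset.sum_congr rfl fun i _ => by ring
  rw [e, integral_finsetSum _ fun i _ => (hi i).const_mul _]
  simp only [dotProduct, xi]
  exact Finset.sum_congr rfl fun i _ => by rw [integral_const_mul, mul_comm]

theorem fderiv_integral_rpow (h : BasuConditions M β θ₀ Ω) (hβ : 0 ≤ β) (hθ : θ ∈ Ω)
    (v : EuclideanSpace ℝ (Fin p)) :
    fderiv ℝ (fun t => ∫ x, M.f t x ^ (β + 1) ∂μ) θ v = (β + 1) * (M.xi β θ ⬝ᵥ v) := by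
  have h1 := h.diff_integral.iteratedFDeriv_eq 1 (by norm_num) θ hθ ![v]
  rw [iteratedFDeriv_one_apply, Matrix.cons_val_zero,
    integral_congr_ae (h.iteratedFDeriv_one_rpow_ae hβ hθ v), integral_const_mul,
    ← h.xi_dotProduct hβ hθ] at h1
  exact h1

/-- Measurability of the score is recovered by dividing the integrable function `s f ^ (β + 1)` by
`f ^ (β + 1)`; off the support both sides are zero. -/
theorem aemeasurable_inner_score (h : BasuConditions M β θ₀ Ω) (hβ : 0 ≤ β) (hθ : θ ∈ Ω)
    (v : EuclideanSpace ℝ (Fin p)) : AEMeasurable (fun x => inner ℝ (M.score θ x) v) μ := by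
  have h1 := (h.integrable_inner_score_mul hβ hθ v).1.aemeasurable
  have hf := M.measurable_f θ (h.subset hθ)
  have h2 : AEMeasurable (fun x => inner ℝ (M.score θ x) v * M.f θ x ^ (β + 1) /
    M.f θ x ^ (β + 1)) μ := by fun_prop
  refine h2.congr (Eventually.of_forall fun x => ?_)
  by_cases hx : 0 < M.f θ₀ x
  · have := h.f_pos hθ hx
    exact mul_div_cancel_right₀ _ (Real.rpow_pos_of_pos this _).ne'
  · simp only [h.score_eq_zero hθ hx, inner_zero_left, zero_mul, zero_div]

theorem aemeasurable_score (h : BasuConditions M β θ₀ Ω) (hβ : 0 ≤ β) (hθ : θ ∈ Ω)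
    (i : Fin p) : AEMeasurable (fun x => M.score θ x i) μ := by
  simpa [EuclideanSpace.inner_single_right] using
    h.aemeasurable_inner_score hβ hθ (EuclideanSpace.single i 1)

theorem aemeasurable_u_dotProduct (h : BasuConditions M β θ₀ Ω) (hβ : 0 ≤ β) (hθ : θ ∈ Ω)
    (v : EuclideanSpace ℝ (Fin p)) : AEMeasurable (fun x => M.u β x θ ⬝ᵥ v) μ := by
  simp only [u_dotProduct]
  have := h.aemeasurable_inner_score hβ hθ v
  have hf := M.measurable_f θ (h.subset hθ)
  fun_prop

/-- The Bochner integral of a non-integrable function is zero, so a nonzero diagonal entry forces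
integrability; off-diagonal products are dominated by the squares. Positive diagonals of `J` and `K`
thus supply the moment conditions. -/
theorem integrable_score_mul_score (h : BasuConditions M β θ₀ Ω) (hβ : 0 ≤ β) (hθ : θ ∈ Ω)
    {a : ℝ} (hi : ∀ i, (∫ x, M.score θ x i * M.score θ x i * M.f θ x ^ a ∂μ) ≠ 0) (i j : Fin p) :
    Integrable (fun x => M.score θ x i * M.score θ x j * M.f θ x ^ a) μ := by
  have hf := M.measurable_f θ (h.subset hθ)
  refine integrable_mul_mul_of_integrable_sq (h.aemeasurable_score hβ hθ i)
    (h.aemeasurable_score hβ hθ j) (Measurable.aemeasurable (by fun_prop))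
    (fun x => Real.rpow_nonneg (M.f_nonneg θ (h.subset hθ) x) _) ?_ ?_
  · exact not_imp_comm.1 integral_undef (hi i)
  · exact not_imp_comm.1 integral_undef (hi j)

theorem integrable_score_mul_score_J (h : BasuConditions M β θ₀ Ω) (hβ : 0 ≤ β) (i j : Fin p) :
    Integrable (fun x => M.score θ₀ x i * M.score θ₀ x j * M.f θ₀ x ^ (β + 1)) μ :=
  h.integrable_score_mul_score hβ h.mem (fun i => (h.posDef_J.diag_pos (i := i)).ne') i j

theorem integrable_score_mul_score_K (h : BasuConditions M β θ₀ Ω) (hβ : 0 ≤ β) (hθ : θ ∈ Ω)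
    (hK : ∀ i, 0 < M.K β θ i i) (i j : Fin p) :
    Integrable (fun x => M.score θ x i * M.score θ x j * M.f θ x ^ (2 * β + 1)) μ := by
  refine h.integrable_score_mul_score hβ hθ (fun i h0 => ?_) i j
  have := hK i
  rw [K, Matrix.of_apply, h0] at this
  nlinarith [mul_self_nonneg (M.xi β θ i)]

theorem rpow_mul_self (h : BasuConditions M β θ₀ Ω) (hθ : θ ∈ Ω) (x : 𝓧)
    (v : EuclideanSpace ℝ (Fin p)) (a : ℝ) :
    inner ℝ (M.score θ x) v * M.f θ x ^ a * M.f θ x =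
      inner ℝ (M.score θ x) v * M.f θ x ^ (a + 1) := by
  by_cases hx : 0 < M.f θ₀ x
  · rw [Real.rpow_add_one (h.f_pos hθ hx).ne', mul_assoc]
  · simp [h.score_eq_zero hθ hx]

theorem u_dotProduct_mul_f (h : BasuConditions M β θ₀ Ω) (hθ : θ ∈ Ω)
    (v : EuclideanSpace ℝ (Fin p)) (x : 𝓧) :
    M.u β x θ ⬝ᵥ v * M.f θ x =
      inner ℝ (M.score θ x) v * M.f θ x ^ (β + 1) - (M.xi β θ ⬝ᵥ v) * M.f θ x := by
  rw [u_dotProduct, sub_mul, h.rpow_mul_self hθ]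

theorem integral_u_dotProduct_mul_f (h : BasuConditions M β θ₀ Ω) (hβ : 0 ≤ β) (hθ : θ ∈ Ω)
    (v : EuclideanSpace ℝ (Fin p)) :
    Integrable (fun x => M.u β x θ ⬝ᵥ v * M.f θ x) μ ∧
      ∫ x, M.u β x θ ⬝ᵥ v * M.f θ x ∂μ = 0 := by
  simp only [h.u_dotProduct_mul_f hθ]
  have h1 := h.integrable_inner_score_mul hβ hθ v
  have h2 := (integrable_f (h.subset hθ)).const_mul (M.xi β θ ⬝ᵥ v)
  refine ⟨h1.sub h2, ?_⟩
  rw [integral_sub h1 h2, ← h.xi_dotProduct hβ hθ, integral_const_mul,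
    integral_f (h.subset hθ), mul_one, sub_self]

theorem integral_u_dotProduct_sq_mul_f (h : BasuConditions M β θ₀ Ω) (hβ : 0 ≤ β) (hθ : θ ∈ Ω)
    (hK : ∀ i, 0 < M.K β θ i i) (v : EuclideanSpace ℝ (Fin p)) :
    Integrable (fun x => (M.u β x θ ⬝ᵥ v) ^ 2 * M.f θ x) μ ∧
      ∫ x, (M.u β x θ ⬝ᵥ v) ^ 2 * M.f θ x ∂μ = v ⬝ᵥ (M.K β θ).mulVec v := by
  set c := M.xi β θ ⬝ᵥ v with hc
  have e : (fun x => (M.u β x θ ⬝ᵥ v) ^ 2 * M.f θ x) = fun x =>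
      inner ℝ (M.score θ x) v * inner ℝ (M.score θ x) v * M.f θ x ^ (2 * β + 1) -
        2 * c * (inner ℝ (M.score θ x) v * M.f θ x ^ (β + 1)) + c ^ 2 * M.f θ x := by
    funext x
    rw [u_dotProduct, ← hc]
    -- Exponents add only at a positive base; off the support the score and the density are both
    -- zero.
    by_cases hx : 0 < M.f θ₀ x
    · have hp := h.f_pos hθ hx
      rw [Real.rpow_add_one hp.ne', Real.rpow_add_one hp.ne', two_mul β, Real.rpow_add hp]
      ring
    · simp only [h.score_eq_zero hθ hx, inner_zero_left]
      ring
  obtain ⟨i1, e1⟩ := integral_inner_score_mul_inner_score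
    (h.integrable_score_mul_score_K hβ hθ hK) v v
  have i2 := (h.integrable_inner_score_mul hβ hθ v).const_mul (2 * c)
  have i3 := (integrable_f (h.subset hθ)).const_mul (c ^ 2)
  have i4 : Integrable (fun x =>
      inner ℝ (M.score θ x) v * inner ℝ (M.score θ x) v * M.f θ x ^ (2 * β + 1) -
        2 * c * (inner ℝ (M.score θ x) v * M.f θ x ^ (β + 1))) μ := i1.sub i2
  rw [e]
  refine ⟨i4.add i3, ?_⟩
  rw [integral_add i4 i3, integral_sub i1 i2, e1, integral_const_mul, integral_const_mul,
    ← h.xi_dotProduct hβ hθ, integral_f (h.subset hθ), ← hc]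
  have : M.K β θ = (Matrix.of fun i j =>
      ∫ x, M.score θ x i * M.score θ x j * M.f θ x ^ (2 * β + 1) ∂μ) -
        Matrix.vecMulVec (M.xi β θ) (M.xi β θ) := by
    ext i j
    simp [K, Matrix.vecMulVec_apply]
  rw [this, Matrix.sub_mulVec, dotProduct_sub, Matrix.vecMulVec_mulVec, ← hc]
  have h4 : (v : Fin p → ℝ) ⬝ᵥ MulOpposite.op c • M.xi β θ = c * c := by
    rw [op_smul_eq_smul, dotProduct_smul, dotProduct_comm, ← hc, smul_eq_mul]
  rw [h4]
  ring

/-! ### The loss: its gradient is the score, its expected Hessian is `J`. -/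

section Loss

theorem loss_eq (M : DensityModel μ p) (β : ℝ) (x : 𝓧) :
    (fun t => M.loss β t x) =
      (if β = 0 then 0 else fun t => ∫ y, M.f t y ^ (β + 1) ∂μ) +
        (if β = 0 then fun t => -Real.log (M.f t x) else
          fun t => -((1 + 1 / β) * M.f t x ^ β)) := by
  funext t
  by_cases hb : β = 0
  · simp [loss, hb]
  · simp [loss, hb, add_comm β 1, sub_eq_add_neg]

/-- For `β = 0` the integral is the total mass. Its derivative, and with it `xi`, vanishes, so the
logarithmic loss obeys the same gradient formula as the case `β > 0`. -/
theorem integral_rpow_eventuallyEq (h : BasuConditions M β θ₀ Ω) (hb : β = 0) (hθ : θ ∈ Ω) :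
    (fun t => ∫ x, M.f t x ^ (β + 1) ∂μ) =ᶠ[𝓝 θ] fun _ => 1 := by
  filter_upwards [h.isOpen.mem_nhds hθ] with t ht
  simp only [hb, zero_add, Real.rpow_one]
  exact integral_f (h.subset ht)

variable {x : 𝓧}

theorem differentiableAt_iteratedFDeriv_loss (h : BasuConditions M β θ₀ Ω) (hx : 0 < M.f θ₀ x)
    (hc : ContDiffOn ℝ 3 (fun t => M.f t x) Ω) :
    ∀ k < 3, ∀ θ ∈ Ω, DifferentiableAt ℝ (iteratedFDeriv ℝ k fun t => M.loss β t x) θ := by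
  rw [loss_eq]
  refine differentiableAt_iteratedFDeriv_add h.isOpen ?_ ?_
  · split_ifs
    · exact fun k hk θ hθ => differentiableAt_iteratedFDeriv_of_contDiffOn h.isOpen
        (F := 0) contDiffOn_const hk hθ
    · exact h.diff_integral.differentiableAt
  · split_ifs
    · exact (h.contDiffOn_log hx hc).neg
    · exact (contDiffOn_const.mul (h.contDiffOn_rpow hx hc β)).neg

/-- This identity lets the bounds on third derivatives of the loss control the Taylor remainder of
the score. -/
theorem fderiv_loss (h : BasuConditions M β θ₀ Ω) (hβ : 0 ≤ β) (hx : 0 < M.f θ₀ x)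
    (hc : ContDiffOn ℝ 3 (fun t => M.f t x) Ω) (hθ : θ ∈ Ω) (v : EuclideanSpace ℝ (Fin p)) :
    fderiv ℝ (fun t => M.loss β t x) θ v = -(β + 1) * (M.u β x θ ⬝ᵥ v) := by
  have hx2 := h.fderiv_integral_rpow hβ hθ v
  rw [u_dotProduct]
  by_cases hb : β = 0
  · rw [(h.integral_rpow_eventuallyEq hb hθ).fderiv_eq] at hx2
    have h0 : M.xi β θ ⬝ᵥ v = 0 := by
      simpa [show β + 1 ≠ 0 by linarith] using hx2.symm
    rw [h0, inner_score]
    simp [loss, hb, fderiv_fun_neg]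
  · have hd1 : DifferentiableAt ℝ (fun t => ∫ y, M.f t y ^ (β + 1) ∂μ) θ :=
      ((contDiffOn_two_of_differentiableAt_iteratedFDeriv h.isOpen
        h.diff_integral.differentiableAt).contDiffAt (h.isOpen.mem_nhds hθ)).differentiableAt
        (by norm_num)
    have hd2 := h.differentiableAt_f_rpow hx hc hθ β
    simp only [loss, hb, if_false, add_comm 1 β]
    rw [fderiv_fun_sub hd1 (hd2.const_mul _), sub_apply, hx2,
      fderiv_const_mul hd2, smul_apply, h.fderiv_rpow hx hc hθ, smul_eq_mul]
    field_simp
    ring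

theorem iteratedFDeriv_two_loss (h : BasuConditions M β θ₀ Ω) (hβ : 0 ≤ β) (hx : 0 < M.f θ₀ x)
    (hc : ContDiffOn ℝ 3 (fun t => M.f t x) Ω) (hθ : θ ∈ Ω) (d v : EuclideanSpace ℝ (Fin p)) :
    iteratedFDeriv ℝ 2 (fun t => M.loss β t x) θ ![d, v] =
      iteratedFDeriv ℝ 2 (fun t => ∫ y, M.f t y ^ (β + 1) ∂μ) θ ![d, v] -
        (β + 1) * (M.f θ x ^ β * (β * (inner ℝ (M.score θ x) d * inner ℝ (M.score θ x) v) +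
          fderiv ℝ (fun t => inner ℝ (M.score t x) v) θ d)) := by
  have hd : ∀ {F : EuclideanSpace ℝ (Fin p) → ℝ},
      (∀ k < 3, ∀ θ ∈ Ω, DifferentiableAt ℝ (iteratedFDeriv ℝ k F) θ) →
      DifferentiableAt ℝ (fderiv ℝ F) θ := fun hF => by
    have h1 := (contDiffOn_two_of_differentiableAt_iteratedFDeriv h.isOpen hF).contDiffAt
      (h.isOpen.mem_nhds hθ)
    exact (h1.fderiv_right (m := 1) (by norm_num)).differentiableAt (by norm_num)
  have hd1 := hd (h.differentiableAt_iteratedFDeriv_loss hx hc)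
  have hd2 := hd h.diff_integral.differentiableAt
  rw [iteratedFDeriv_two_apply_eq_fderiv hd1, iteratedFDeriv_two_apply_eq_fderiv hd2]
  have e : (fun t => fderiv ℝ (fun t => M.loss β t x) t v) =ᶠ[𝓝 θ]
      fun t => fderiv ℝ (fun t => ∫ y, M.f t y ^ (β + 1) ∂μ) t v -
        (β + 1) * (M.f t x ^ β * inner ℝ (M.score t x) v) := by
    filter_upwards [h.isOpen.mem_nhds hθ] with t ht
    rw [h.fderiv_loss hβ hx hc ht, u_dotProduct, h.fderiv_integral_rpow hβ ht]
    ring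
  have hd3 := (h.differentiableAt_f_rpow hx hc hθ β).fun_mul
    (h.differentiableAt_inner_score hx hc hθ v)
  rw [e.fderiv_eq, fderiv_fun_sub (hd2.clm_apply (differentiableAt_const v)) (hd3.const_mul _),
    fderiv_const_mul hd3, sub_apply, smul_apply, h.fderiv_rpow_mul_inner_score hx hc hθ,
    smul_eq_mul]

/-- The expected Hessian of the loss at the true parameter. -/
theorem integral_iteratedFDeriv_two_loss (h : BasuConditions M β θ₀ Ω) (hβ : 0 ≤ β)
    (d v : EuclideanSpace ℝ (Fin p)) :
    Integrable (fun x => iteratedFDeriv ℝ 2 (fun t => M.loss β t x) θ₀ ![d, v] * M.f θ₀ x) μ ∧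
      ∫ x, iteratedFDeriv ℝ 2 (fun t => M.loss β t x) θ₀ ![d, v] * M.f θ₀ x ∂μ =
        (β + 1) * (d ⬝ᵥ (M.J β θ₀).mulVec v) := by
  set c := iteratedFDeriv ℝ 2 (fun t => ∫ y, M.f t y ^ (β + 1) ∂μ) θ₀ ![d, v] with hc
  -- The derivatives of the score, about which no integrability is assumed, are absorbed into the
  -- Hessian of `f ^ (β + 1)`. That Hessian integrates to `c`, cancelling the first term, and only
  -- `(β + 1) J` is left.
  have e : (fun x => iteratedFDeriv ℝ 2 (fun t => M.loss β t x) θ₀ ![d, v] * M.f θ₀ x) =ᵐ[μ]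
      fun x => c * M.f θ₀ x + (β + 1) * (inner ℝ (M.score θ₀ x) d * inner ℝ (M.score θ₀ x) v *
        M.f θ₀ x ^ (β + 1)) - iteratedFDeriv ℝ 2 (fun t => M.f t x ^ (β + 1)) θ₀ ![d, v] := by
    filter_upwards [h.contDiffOn] with x hcx
    by_cases hx : 0 < M.f θ₀ x
    · rw [h.iteratedFDeriv_two_loss hβ hx (hcx hx) h.mem,
        h.iteratedFDeriv_two_rpow hx (hcx hx) h.mem, ← hc, Real.rpow_add_one hx.ne']
      ring
    · have e0 : (fun t => M.f t x ^ (β + 1)) =ᶠ[𝓝 θ₀] fun _ => 0 := by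
        filter_upwards [h.f_eventuallyEq_zero h.mem hx] with t ht
        rw [ht, Real.zero_rpow (by linarith)]
      rw [(e0.iteratedFDeriv ℝ 2).eq_of_nhds, h.f_eq_zero (h.subset h.mem) hx,
        h.score_eq_zero h.mem hx]
      simp [show (fun _ : EuclideanSpace ℝ (Fin p) => (0 : ℝ)) = 0 from rfl]
  have i1 := (integrable_f (h.subset h.mem)).const_mul c
  obtain ⟨i2, e2⟩ := integral_inner_score_mul_inner_score (h.integrable_score_mul_score_J hβ) d v
  have i3 := h.diff_integral.integrable 2 (by norm_num) θ₀ h.mem ![d, v]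
  refine ⟨((i1.add (i2.const_mul _)).sub i3).congr e.symm, ?_⟩
  rw [integral_congr_ae e, integral_sub (i1.fun_add (i2.const_mul _)) i3,
    integral_add i1 (i2.const_mul _), integral_const_mul, integral_const_mul, e2,
    ← h.diff_integral.iteratedFDeriv_eq 2 (by norm_num) θ₀ h.mem ![d, v], ← hc,
    integral_f (h.subset h.mem)]
  simp only [J]
  ring

end Loss

end BasuConditions

/-! ### Asymptotics of the normalised score. -/

theorem tendsto_natCast_rpow_neg_half :
    Tendsto (fun n : ℕ => (n : ℝ) ^ (-(1 / 2) : ℝ)) atTop (𝓝 0) :=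
  (tendsto_rpow_neg_atTop (by norm_num)).comp tendsto_natCast_atTop_atTop

theorem natCast_rpow_neg_half (n : ℕ) : (n : ℝ) ^ (-(1 / 2) : ℝ) = (√n)⁻¹ := by
  rw [Real.rpow_neg (Nat.cast_nonneg n), ← Real.sqrt_eq_rpow]

namespace DensityModel

variable {𝓧 : Type*} [MeasurableSpace 𝓧] {μ : Measure 𝓧} {p : ℕ} {M : DensityModel μ p}

/-- The component in direction `v` of `√n U_{β,n}(θ)`. -/
def scaledScore (M : DensityModel μ p) (β : ℝ) (n : ℕ) (θ v : EuclideanSpace ℝ (Fin p))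
    (X : Fin n → 𝓧) : ℝ :=
  (√n)⁻¹ * ∑ i, M.u β (X i) θ ⬝ᵥ v

theorem ae_sampleLaw_of_ae_law {n : ℕ} (θ : M.Θ) {q : 𝓧 → Prop} (hq : ∀ᵐ x ∂M.law θ, q x) :
    ∀ᵐ X ∂M.sampleLaw n θ, ∀ i, q (X i) :=
  ae_all_iff.2 fun i => (Measure.quasiMeasurePreserving_eval (fun _ : Fin n => M.law θ) i).ae hq

theorem aemeasurable_sampleLaw_comp_eval {n : ℕ} (θ : M.Θ) {g : 𝓧 → ℝ} (hg : AEMeasurable g μ)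
    (i : Fin n) : AEMeasurable (fun X => g (X i)) (M.sampleLaw n θ) :=
  (hg.mono_ac (withDensity_absolutelyContinuous _ _)).comp_quasiMeasurePreserving
    (Measure.quasiMeasurePreserving_eval (fun _ : Fin n => M.law θ) i)

theorem ae_law_pos (θ : M.Θ) : ∀ᵐ x ∂M.law θ, 0 < M.f θ x := by
  rw [law, ae_withDensity_iff (M.measurable_f θ θ.2).ennreal_ofReal]
  refine Eventually.of_forall fun x hx => ?_
  exact ENNReal.ofReal_pos.1 (pos_iff_ne_zero.2 hx)

end DensityModel

namespace BasuConditions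

open DensityModel

variable {𝓧 : Type*} [MeasurableSpace 𝓧] {μ : Measure 𝓧} {p : ℕ} {M : DensityModel μ p} {β : ℝ}
  {Ω : Set (EuclideanSpace ℝ (Fin p))}

theorem aemeasurable_scaledScore {θ₀ : EuclideanSpace ℝ (Fin p)} (h : BasuConditions M β θ₀ Ω)
    (hβ : 0 ≤ β) {n : ℕ} {θ : EuclideanSpace ℝ (Fin p)} (hθ : θ ∈ Ω)
    (v : EuclideanSpace ℝ (Fin p)) (θ' : M.Θ) :
    AEMeasurable (M.scaledScore β n θ v) (M.sampleLaw n θ') :=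
  (Finset.aemeasurable_fun_sum _ fun i _ => aemeasurable_sampleLaw_comp_eval θ'
    (h.aemeasurable_u_dotProduct hβ hθ v) i).const_mul _

/-- The central limit theorem for the score statistic along converging parameters. -/
theorem tendsto_integral_exp_scaledScore {θ₀ : EuclideanSpace ℝ (Fin p)}
    (h : BasuConditions M β θ₀ Ω) (hβ : 0 ≤ β) (hK : (M.K β θ₀).PosDef)
    (hKcont : ContinuousAt (M.K β) θ₀) {θ : ℕ → M.Θ}
    (hθ : Tendsto (fun n => (θ n : EuclideanSpace ℝ (Fin p))) atTop (𝓝 θ₀))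
    (v : EuclideanSpace ℝ (Fin p)) :
    Tendsto (fun n => ∫ X, Complex.exp (M.scaledScore β n (θ n) v X * Complex.I)
      ∂M.sampleLaw n (θ n)) atTop
      (𝓝 (Complex.exp (-((v ⬝ᵥ (M.K β θ₀).mulVec v) / 2 : ℝ)))) := by
  have hΩ : ∀ᶠ n in atTop, (θ n : EuclideanSpace ℝ (Fin p)) ∈ Ω :=
    hθ.eventually (h.isOpen.mem_nhds h.mem)
  have hKlim := hKcont.tendsto.comp hθ
  have hKij : ∀ i j, Tendsto (fun n => M.K β (θ n) i j) atTop (𝓝 (M.K β θ₀ i j)) := fun i j =>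
    tendsto_pi_nhds.1 (tendsto_pi_nhds.1 hKlim i) j
  -- Continuity of `K` keeps its diagonal positive near `θ₀`, which gives square integrability of
  -- the score at `θ n`.
  have hKpos : ∀ᶠ n in atTop, ∀ i, 0 < M.K β (θ n) i i :=
    eventually_all.2 fun i => (hKij i i).eventually_const_lt hK.diag_pos
  obtain ⟨i0, e0⟩ := h.integral_u_dotProduct_sq_mul_f hβ h.mem (fun i => hK.diag_pos) v
  have key := tendsto_natCast_mul_integral_exp_sub_one (μ := μ)
    (ρ := fun n => M.f (θ n)) (Y := fun n x => M.u β x (θ n) ⬝ᵥ v) (r := M.f θ₀)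
    (y := fun x => M.u β x θ₀ ⬝ᵥ v)
    (Eventually.of_forall fun n => M.f_nonneg _ (θ n).2) (M.f_nonneg _ (h.subset h.mem))
    (Eventually.of_forall fun n => M.measurable_f _ (θ n).2)
    (Eventually.of_forall fun n => integrable_f (θ n).2)
    (hΩ.mono fun n hn => h.aemeasurable_u_dotProduct hβ hn v)
    (hΩ.mono fun n hn => (h.integral_u_dotProduct_mul_f hβ hn v).1)
    (hΩ.mono fun n hn => (h.integral_u_dotProduct_mul_f hβ hn v).2)
    ((hΩ.and hKpos).mono fun n hn => (h.integral_u_dotProduct_sq_mul_f hβ hn.1 hn.2 v).1) i0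
    ?_ ?_
  · rw [e0] at key
    -- By independence the characteristic function is an `n`-th power `φ n ^ n`, and `key` says that
    -- `n (φ n - 1)` tends to minus half the variance.
    have hpow := Complex.tendsto_one_add_pow_exp_of_tendsto key
    refine hpow.congr fun n => ?_
    have e1 : ∀ X : Fin n → 𝓧, Complex.exp (M.scaledScore β n (θ n) v X * Complex.I) =
        ∏ i, Complex.exp (((√n)⁻¹ * (M.u β (X i) (θ n) ⬝ᵥ v) : ℝ) * Complex.I) := by
      intro X
      rw [← Complex.exp_sum, scaledScore, ← Finset.sum_mul, Finset.mul_sum]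
      push_cast
      rfl
    simp_rw [e1, sampleLaw]
    rw [integral_fintype_prod_eq_pow (fun x =>
      Complex.exp (((√n)⁻¹ * (M.u β x (θ n) ⬝ᵥ v) : ℝ) * Complex.I)), Fintype.card_fin,
      integral_law, integral_complex_ofReal, integral_f (θ n).2]
    congr 1
    simp only [Complex.real_smul, Complex.ofReal_one, add_sub_cancel]
    exact integral_congr_ae (Eventually.of_forall fun x => mul_comm _ _)
  · filter_upwards [h.contDiffOn] with x hc
    by_cases hx : 0 < M.f θ₀ x
    · right
      have hcf : ContinuousAt (fun t => M.f t x) θ₀ :=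
        ((hc hx).contDiffAt (h.isOpen.mem_nhds h.mem)).continuousAt
      refine ⟨hcf.tendsto.comp hθ, ?_⟩
      -- `xi` is the gradient of a `C²` function divided by `β + 1`, hence continuous.
      have hxi : ContinuousAt (fun t => M.xi β t ⬝ᵥ v) θ₀ := by
        have h1 := (contDiffOn_two_of_differentiableAt_iteratedFDeriv h.isOpen
          h.diff_integral.differentiableAt).contDiffAt (h.isOpen.mem_nhds h.mem)
        have h2 : ContinuousAt (fun t => (β + 1)⁻¹ *
            fderiv ℝ (fun t => ∫ y, M.f t y ^ (β + 1) ∂μ) t v) θ₀ :=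
          continuousAt_const.mul
            ((h1.fderiv_right (m := 1) (by norm_num)).continuousAt.clm_apply continuousAt_const)
        refine h2.congr ?_
        filter_upwards [h.isOpen.mem_nhds h.mem] with t ht
        have : β + 1 ≠ 0 := by linarith
        rw [h.fderiv_integral_rpow hβ ht]
        field_simp
      have hu : ContinuousAt (fun t => M.u β x t ⬝ᵥ v) θ₀ := by
        simp only [u_dotProduct]
        exact ((h.differentiableAt_inner_score hx (hc hx) h.mem v).continuousAt.mul
          (h.differentiableAt_f_rpow hx (hc hx) h.mem β).continuousAt).sub hxi
      exact hu.tendsto.comp hθ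
    · left
      exact ⟨Eventually.of_forall fun n => h.f_eq_zero (θ n).2 hx,
        h.f_eq_zero (h.subset h.mem) hx⟩
  · rw [e0]
    have h1 : Tendsto (fun n => v ⬝ᵥ (M.K β (θ n)).mulVec v) atTop
        (𝓝 (v ⬝ᵥ (M.K β θ₀).mulVec v)) := by
      simp only [dotProduct, Matrix.mulVec]
      exact tendsto_finsetSum _ fun i _ => (tendsto_finsetSum _ fun j _ =>
        (hKij i j).mul_const _).const_mul _
    refine h1.congr' ?_
    filter_upwards [hΩ, hKpos] with n hn hn'
    rw [(h.integral_u_dotProduct_sq_mul_f hβ hn hn' v).2]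

/-- The regularity conditions bound the coordinate derivatives only; by multilinearity finitely many
of these bounds combine to one for arbitrary directions. -/
theorem exists_bound_iteratedFDeriv_three_loss {θ₀ : M.Θ} (h : BasuConditions M β θ₀ Ω)
    (a b c : EuclideanSpace ℝ (Fin p)) :
    ∃ C : 𝓧 → ℝ, Integrable C (M.law θ₀) ∧ ∀ᵐ x ∂μ, 0 < M.f θ₀ x → ∀ t ∈ Ω,
      |iteratedFDeriv ℝ 3 (fun t => M.loss β t x) t ![a, b, c]| ≤ C x := by
  choose ζ hζ hle using h.third_deriv_le
  refine ⟨fun x => ∑ r : Fin 3 → Fin p,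
      (∏ i, |(![a, b, c] i : EuclideanSpace ℝ (Fin p)) (r i)|) * ζ (r 0) (r 1) (r 2) x,
    integrable_finsetSum _ fun r _ =>
      ((integrable_law_iff θ₀).2 (hζ (r 0) (r 1) (r 2))).const_mul _, ?_⟩
  have : ∀ᵐ x ∂μ, ∀ j k l, 0 < M.f θ₀ x → ∀ θ ∈ Ω,
      |iteratedFDeriv ℝ 3 (fun t => M.loss β t x) θ
        ![EuclideanSpace.single j 1, EuclideanSpace.single k 1, EuclideanSpace.single l 1]| ≤
        ζ j k l x :=
    ae_all_iff.2 fun j => ae_all_iff.2 fun k => ae_all_iff.2 fun l => hle j k l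
  filter_upwards [this] with x hx hx0 t ht
  exact abs_trilinear_le_sum _ a b c fun j k l => hx j k l hx0 t ht

/-- Under the null hypothesis, moving the parameter of the score statistic by `n^(-1/2) d` shifts
it asymptotically by `J d`. -/
theorem tendsto_sampleLaw_abs_scaledScore_sub {θ₀ : M.Θ} (h : BasuConditions M β θ₀ Ω)
    (hβ : 0 ≤ β) {d : EuclideanSpace ℝ (Fin p)} {θ : ℕ → M.Θ}
    (hθ : ∀ᶠ n : ℕ in atTop,
      (θ n : EuclideanSpace ℝ (Fin p)) = θ₀ + ((n : ℝ) ^ (-(1 / 2) : ℝ)) • d)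
    (v : EuclideanSpace ℝ (Fin p)) {ε : ℝ} (hε : 0 < ε) :
    Tendsto (fun n => M.sampleLaw n θ₀ {X | ε ≤ |M.scaledScore β n θ₀ v X -
      M.scaledScore β n (θ n) v X - d ⬝ᵥ (M.J β θ₀).mulVec v|}) atTop (𝓝 0) := by
  obtain ⟨C, hCi, hC⟩ := h.exists_bound_iteratedFDeriv_three_loss d d v
  set D : 𝓧 → ℝ := fun x => iteratedFDeriv ℝ 2 (fun t => M.loss β t x) θ₀ ![d, v] with hD
  obtain ⟨hDi, hDe⟩ := h.integral_iteratedFDeriv_two_loss hβ d v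
  have hDl : Integrable D (M.law θ₀) := (integrable_law_iff θ₀).2 hDi
  have hDE : ∫ x, D x ∂M.law θ₀ = (β + 1) * (d ⬝ᵥ (M.J β θ₀).mulVec v) := by
    rw [integral_law, ← hDe]
    exact integral_congr_ae (Eventually.of_forall fun x => mul_comm _ _)
  -- Two averages must be under control: the Hessian up to `ε / 2`, and the third derivative bound
  -- up to 1, so that it stays below `c + 1`.
  have t1 := tendsto_pi_measure_abs_average_sub (M.law θ₀) hDl (half_pos hε)
  have t2 := tendsto_pi_measure_abs_average_sub (M.law θ₀) hCi one_pos
  set c : ℝ := ∫ x, C x ∂M.law θ₀ with hc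
  have hs := tendsto_natCast_rpow_neg_half
  simp only [natCast_rpow_neg_half] at hs hθ
  obtain ⟨r, hr, hball⟩ := Metric.isOpen_iff.1 h.isOpen θ₀ h.mem
  have hs1 : ∀ᶠ n : ℕ in atTop, (√n)⁻¹ * ‖d‖ < r := by
    have := hs.mul_const ‖d‖
    rw [zero_mul] at this
    exact this.eventually_lt_const hr
  have hs2 : ∀ᶠ n : ℕ in atTop, (√n)⁻¹ * (c + 1) < ε / 2 := by
    have := hs.mul_const (c + 1)
    rw [zero_mul] at this
    exact this.eventually_lt_const (half_pos hε)
  have hae : ∀ᵐ x ∂M.law θ₀, 0 < M.f θ₀ x ∧ (0 < M.f θ₀ x → ContDiffOn ℝ 3 (fun t => M.f t x) Ω) ∧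
      (0 < M.f θ₀ x → ∀ t ∈ Ω, |iteratedFDeriv ℝ 3 (fun t => M.loss β t x) t ![d, d, v]| ≤ C x) :=
    (ae_law_pos θ₀).and ((withDensity_absolutelyContinuous _ _).ae_le (h.contDiffOn.and hC))
  have hsum := t1.add t2
  rw [add_zero] at hsum
  refine tendsto_of_tendsto_of_tendsto_of_le_of_le' tendsto_const_nhds hsum
    (Eventually.of_forall fun _ => zero_le) ?_
  filter_upwards [hθ, hs1, hs2, eventually_gt_atTop 0] with n hn hn1 hn2 hn0
  refine le_trans (measure_mono_ae ?_) (measure_union_le _ _)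
  filter_upwards [ae_sampleLaw_of_ae_law (n := n) θ₀ hae] with X hX
  intro hbig
  by_contra hnot
  change X ∉ (_ ∪ _ : Set (Fin n → 𝓧)) at hnot
  change ε ≤ _ at hbig
  rw [Set.mem_union, not_or, Set.mem_ofPred_eq, Set.mem_ofPred_eq, not_le, not_le] at hnot
  obtain ⟨hn3, hn4⟩ := hnot
  have hn' : (0 : ℝ) < n := by exact_mod_cast hn0
  have hq : (√(n : ℝ))⁻¹ * (√(n : ℝ))⁻¹ = (n : ℝ)⁻¹ := by
    rw [← mul_inv, Real.mul_self_sqrt hn'.le]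
  set a : ℝ := (√(n : ℝ))⁻¹ with ha
  have ha0 : 0 ≤ a := by positivity
  have hβ1 : 0 < β + 1 := by linarith
  have hseg : ∀ s ∈ Set.Icc 0 a, (θ₀ : EuclideanSpace ℝ (Fin p)) + s • d ∈ Ω := by
    intro s hs
    apply hball
    rw [Metric.mem_ball, dist_eq_norm, add_sub_cancel_left, norm_smul, Real.norm_eq_abs,
      abs_of_nonneg hs.1]
    exact (mul_le_mul_of_nonneg_right hs.2 (norm_nonneg _)).trans_lt hn1
  -- Taylor expansion of the loss gradient from `θ₀` to `θ n`; the minus sign in the gradient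
  -- formula puts the score at `θ₀` first.
  have hterm : ∀ i, |(β + 1) * (M.u β (X i) θ₀ ⬝ᵥ v - M.u β (X i) (θ n) ⬝ᵥ v) - a * D (X i)| ≤
      C (X i) * a ^ 2 := by
    intro i
    obtain ⟨hx, hcd, hb⟩ := hX i
    have := abs_fderiv_add_smul_sub_le (h.differentiableAt_iteratedFDeriv_loss hx (hcd hx)) ha0
      hseg (hb hx)
    rw [h.fderiv_loss hβ hx (hcd hx) h.mem, h.fderiv_loss hβ hx (hcd hx)
      (hseg a ⟨ha0, le_rfl⟩), ← hn] at this
    refine le_of_eq_of_le ?_ this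
    congr 1
    ring
  have htot : |(β + 1) * (M.scaledScore β n θ₀ v X - M.scaledScore β n (θ n) v X) -
      (n : ℝ)⁻¹ * ∑ i, D (X i)| ≤ a * ((n : ℝ)⁻¹ * ∑ i, C (X i)) := by
    have e : (β + 1) * (M.scaledScore β n θ₀ v X - M.scaledScore β n (θ n) v X) -
        (n : ℝ)⁻¹ * ∑ i, D (X i) = a * ∑ i, ((β + 1) *
          (M.u β (X i) θ₀ ⬝ᵥ v - M.u β (X i) (θ n) ⬝ᵥ v) - a * D (X i)) := by
      rw [Finset.sum_sub_distrib, ← Finset.mul_sum, ← Finset.mul_sum, Finset.sum_sub_distrib,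
        ← hq, scaledScore, scaledScore]
      ring
    rw [e, abs_mul, abs_of_nonneg ha0]
    refine mul_le_mul_of_nonneg_left ?_ ha0
    refine (Finset.abs_sum_le_sum_abs _ _).trans ((Finset.sum_le_sum fun i _ => hterm i).trans
      (le_of_eq ?_))
    rw [← Finset.sum_mul, sq, hq, mul_comm]
  rw [hDE] at hn3
  set S := M.scaledScore β n θ₀ v X - M.scaledScore β n (θ n) v X
  set j := d ⬝ᵥ (M.J β θ₀).mulVec v
  -- Half of `ε` pays for the Hessian average, half for the remainder `a (c + 1)`. Since `β + 1 ≥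
  -- 1`, this contradicts `ε ≤ |S - j|`.
  have h5 : (β + 1) * |S - j| < ε := by
    rw [← abs_of_pos hβ1, ← abs_mul, mul_sub]
    have h6 : a * ((n : ℝ)⁻¹ * ∑ i, C (X i)) ≤ a * (c + 1) :=
      mul_le_mul_of_nonneg_left (by linarith [(abs_lt.1 hn4).2]) ha0
    have h7 := abs_sub_le ((β + 1) * S) ((n : ℝ)⁻¹ * ∑ i, D (X i)) ((β + 1) * j)
    linarith
  nlinarith [abs_nonneg (S - j)]

end BasuConditions

/-! ### Whitening and the limit law of the statistic. -/

open scoped MatrixOrder in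
/-- The inverse of a positive definite real matrix is `Bᵀ * B` for a whitening matrix `B`. -/
theorem Matrix.PosDef.exists_whitening {ι : Type*} [Fintype ι] [DecidableEq ι]
    {A : Matrix ι ι ℝ} (hA : A.PosDef) :
    ∃ B : Matrix ι ι ℝ, A⁻¹ = B.transpose * B ∧ B * A * B.transpose = 1 := by
  obtain ⟨B, hB⟩ := CStarAlgebra.nonneg_iff_eq_star_mul_self.mp hA.inv.posSemidef.nonneg
  rw [Matrix.star_eq_conjTranspose, Matrix.conjTranspose_eq_transpose_of_trivial] at hB
  refine ⟨B, hB, ?_⟩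
  have hdet : IsUnit A.det := (Matrix.isUnit_iff_isUnit_det _).1 hA.isUnit
  have h1 : B.transpose * (B * A) = 1 := by
    rw [← mul_assoc, ← hB, Matrix.nonsing_inv_mul _ hdet]
  -- For square matrices a right inverse is a left inverse, so `Bᵀ` can move to the other side.
  exact mul_eq_one_comm.1 h1

theorem EuclideanSpace.norm_toLp_mulVec_sq {p : ℕ} (B : Matrix (Fin p) (Fin p) ℝ)
    (w : Fin p → ℝ) : ‖WithLp.toLp 2 (B.mulVec w)‖ ^ 2 = w ⬝ᵥ (B.transpose * B).mulVec w := by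
  rw [← Matrix.mulVec_mulVec, Matrix.dotProduct_mulVec, Matrix.vecMul_transpose,
    EuclideanSpace.real_norm_sq_eq, dotProduct]
  exact Finset.sum_congr rfl fun i _ => sq _

theorem EuclideanSpace.inner_toLp_mulVec {p : ℕ} (B : Matrix (Fin p) (Fin p) ℝ)
    (w : Fin p → ℝ) (t : EuclideanSpace ℝ (Fin p)) :
    inner ℝ (WithLp.toLp 2 (B.mulVec w)) t = w ⬝ᵥ B.transpose.mulVec t := by
  rw [EuclideanSpace.inner_eq_star_dotProduct, star_trivial, dotProduct_comm,
    Matrix.dotProduct_mulVec, Matrix.vecMul_transpose]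

namespace DensityModel

variable {𝓧 : Type*} [MeasurableSpace 𝓧] {μ : Measure 𝓧} {p : ℕ} {M : DensityModel μ p}

theorem scaledScore_eq (β : ℝ) (n : ℕ) (θ v : EuclideanSpace ℝ (Fin p)) (X : Fin n → 𝓧) :
    M.scaledScore β n θ v X = ((√n)⁻¹ • ∑ i, M.u β (X i) θ) ⬝ᵥ v := by
  rw [scaledScore, smul_dotProduct, sum_dotProduct, smul_eq_mul]

theorem R_eq_norm_sq (β : ℝ) (n : ℕ) (θ : EuclideanSpace ℝ (Fin p)) (X : Fin n → 𝓧)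
    {B : Matrix (Fin p) (Fin p) ℝ} (hB : (M.K β θ)⁻¹ = B.transpose * B) :
    M.R β n θ X = ‖WithLp.toLp 2 (B.mulVec ((√n)⁻¹ • ∑ i, M.u β (X i) θ))‖ ^ 2 := by
  rw [EuclideanSpace.norm_toLp_mulVec_sq, ← hB, R, U]
  simp only [Matrix.mulVec_smul, dotProduct_smul, smul_dotProduct, smul_eq_mul]
  have hq : (√(n : ℝ))⁻¹ * (√(n : ℝ))⁻¹ = (n : ℝ)⁻¹ := by
    rw [← mul_inv, Real.mul_self_sqrt (Nat.cast_nonneg n)]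
  rw [← mul_assoc (√(n : ℝ))⁻¹, hq]
  rcases eq_or_ne (n : ℝ) 0 with h0 | h0
  · simp [h0]
  · field_simp

end DensityModel

open DensityModel in
/-- Under contiguous local alternatives the whitened score statistic is asymptotically Gaussian with
identity covariance. -/
theorem BasuConditions.tendstoInDistribution_whitened {𝓧 : Type*} [MeasurableSpace 𝓧]
    {μ : Measure 𝓧} {p : ℕ} {M : DensityModel μ p} {β : ℝ} (hβ : 0 ≤ β) {θ₀ : M.Θ}
    {Ω : Set (EuclideanSpace ℝ (Fin p))} (hreg : BasuConditions M β θ₀ Ω)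
    (hK : (M.K β θ₀).PosDef) (hKcont : ContinuousAt (M.K β) θ₀)
    {d : EuclideanSpace ℝ (Fin p)} {θ : ℕ → M.Θ}
    (hθ : ∀ᶠ n : ℕ in atTop,
      (θ n : EuclideanSpace ℝ (Fin p)) = θ₀ + ((n : ℝ) ^ (-(1 / 2) : ℝ)) • d)
    (hcont : Contiguous (fun n => M.sampleLaw n (θ n)) (fun n => M.sampleLaw n θ₀))
    {B : Matrix (Fin p) (Fin p) ℝ} (hBK : B * M.K β θ₀ * B.transpose = 1) :
    TendstoInDistribution
      (fun (n : ℕ) (X : Fin n → 𝓧) =>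
        WithLp.toLp 2 (B.mulVec ((√n)⁻¹ • ∑ i, M.u β (X i) (θ₀ : EuclideanSpace ℝ (Fin p)))))
      atTop (fun z => z + WithLp.toLp 2 (B.mulVec ((M.J β θ₀).mulVec d)))
      (fun n => M.sampleLaw n (θ n)) (stdGaussian (EuclideanSpace ℝ (Fin p))) := by
  have hθlim : Tendsto (fun n => (θ n : EuclideanSpace ℝ (Fin p))) atTop
      (𝓝 (θ₀ : EuclideanSpace ℝ (Fin p))) := by
    have h1 : Tendsto (fun n : ℕ => (θ₀ : EuclideanSpace ℝ (Fin p)) +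
        ((n : ℝ) ^ (-(1 / 2) : ℝ)) • d) atTop (𝓝 (θ₀ : EuclideanSpace ℝ (Fin p))) := by
      simpa using (tendsto_natCast_rpow_neg_half.smul_const d).const_add
        (θ₀ : EuclideanSpace ℝ (Fin p))
    exact h1.congr' (hθ.mono fun n hn => hn.symm)
  have hmeas : ∀ n, AEMeasurable (fun X : Fin n → 𝓧 => WithLp.toLp 2
      (B.mulVec ((√n)⁻¹ • ∑ i, M.u β (X i) (θ₀ : EuclideanSpace ℝ (Fin p)))))
      (M.sampleLaw n (θ n)) := by
    intro n
    refine (WithLp.measurable_toLp 2 _).comp_aemeasurable (aemeasurable_pi_iff.2 fun i => ?_)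
    have h1 := hreg.aemeasurable_scaledScore hβ (n := n) hreg.mem
      (WithLp.toLp 2 fun j => B i j) (θ n)
    refine h1.congr (Eventually.of_forall fun X => ?_)
    rw [scaledScore_eq, dotProduct_comm]
    rfl
  refine ⟨hmeas, by fun_prop, ProbabilityMeasure.tendsto_iff_tendsto_charFun.2 fun t => ?_⟩
  -- Pairing the whitened vector with `t` is pairing the raw score with `Bᵀ t`, so one direction `v`
  -- is enough for each `t`.
  set v : EuclideanSpace ℝ (Fin p) := WithLp.toLp 2 (B.transpose.mulVec t) with hv
  have hΩ : ∀ᶠ n in atTop, (θ n : EuclideanSpace ℝ (Fin p)) ∈ Ω :=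
    hθlim.eventually (hreg.isOpen.mem_nhds hreg.mem)
  -- The central limit theorem is taken for the score at `θ n`; the shift is known under the null
  -- law and contiguity carries it over to the alternatives.
  have key := tendsto_integral_exp_of_sub_tendsto (P := fun n => M.sampleLaw n (θ n))
    (A := fun n => M.scaledScore β n (θ n) v) (B := fun n => M.scaledScore β n θ₀ v)
    (hΩ.mono fun n hn => hreg.aemeasurable_scaledScore hβ hn v (θ n))
    (Eventually.of_forall fun n => hreg.aemeasurable_scaledScore hβ hreg.mem v (θ n))
    (fun ε hε => hcont.tendsto_zero
      (hreg.tendsto_sampleLaw_abs_scaledScore_sub hβ hθ v hε))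
    (hreg.tendsto_integral_exp_scaledScore hβ hK hKcont hθlim v)
  have hvar : (v : Fin p → ℝ) ⬝ᵥ (M.K β θ₀).mulVec v = ‖t‖ ^ 2 := by
    rw [hv, Matrix.mulVec_mulVec, Matrix.dotProduct_mulVec, Matrix.vecMul_mulVec,
      Matrix.transpose_transpose, ← mul_assoc, hBK, Matrix.vecMul_one,
      EuclideanSpace.real_norm_sq_eq, dotProduct]
    exact Finset.sum_congr rfl fun i _ => (sq _).symm
  have hmean : (d : Fin p → ℝ) ⬝ᵥ (M.J β θ₀).mulVec v =
      inner ℝ (WithLp.toLp 2 (B.mulVec ((M.J β θ₀).mulVec d))) t := by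
    have hJ : (M.J β θ₀).transpose = M.J β θ₀ := by
      rw [← Matrix.conjTranspose_eq_transpose_of_trivial]
      exact hreg.posDef_J.isHermitian
    rw [EuclideanSpace.inner_toLp_mulVec, Matrix.dotProduct_mulVec]
    conv_lhs => rw [← hJ, Matrix.vecMul_transpose]
  rw [hvar, hmean] at key
  simp only [ProbabilityMeasure.coe_mk]
  rw [charFun_map_add_const, charFun_stdGaussian, mul_comm]
  convert key using 2
  · rename_i n
    rw [charFun_apply, integral_map (hmeas n)
      (Continuous.aestronglyMeasurable (by fun_prop))]
    refine integral_congr_ae (Eventually.of_forall fun X => ?_)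
    simp only
    rw [EuclideanSpace.inner_toLp_mulVec, scaledScore_eq]
  · push_cast
    ring_nf

/-- Convergence in distribution depends on the limit only through its law. -/
theorem MeasureTheory.TendstoInDistribution.of_map_eq {ι E A B : Type*} {S : ι → Type*}
    [∀ i, MeasurableSpace (S i)] [MeasurableSpace A] [MeasurableSpace B] [TopologicalSpace E]
    [MeasurableSpace E] [OpensMeasurableSpace E] {P : ∀ i, Measure (S i)}
    [∀ i, IsProbabilityMeasure (P i)] {Q : Measure A} [IsProbabilityMeasure Q] {Q' : Measure B}
    [IsProbabilityMeasure Q'] {X : ∀ i, S i → E} {l : Filter ι} {Z : A → E} {Z' : B → E}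
    (h : TendstoInDistribution X l Z P Q) (hZ' : AEMeasurable Z' Q') (hmap : Q.map Z = Q'.map Z') :
    TendstoInDistribution X l Z' P Q' := by
  refine ⟨h.forall_aemeasurable, hZ', ?_⟩
  have e : (⟨Q.map Z, Measure.isProbabilityMeasure_map h.aemeasurable_limit⟩ :
      ProbabilityMeasure E) = ⟨Q'.map Z', Measure.isProbabilityMeasure_map hZ'⟩ := Subtype.ext hmap
  rw [← e]
  exact h.tendsto

theorem mainTheorem3 {𝓧 : Type*} [MeasurableSpace 𝓧] {μ : Measure 𝓧} [SigmaFinite μ] {p : ℕ}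
    (M : DensityModel μ p) (β : ℝ) (hβ : 0 ≤ β)
    (θ₀ : M.Θ) (Ω : Set (EuclideanSpace ℝ (Fin p)))
    (hreg : BasuConditions M β θ₀ Ω)
    (hK : (M.K β θ₀).PosDef) (hKcont : ContinuousAt (M.K β) θ₀)
    (d : EuclideanSpace ℝ (Fin p)) (θ : ℕ → M.Θ)
    (hθ : ∀ᶠ n : ℕ in atTop,
      (θ n : EuclideanSpace ℝ (Fin p)) = θ₀ + ((n : ℝ) ^ (-(1 / 2) : ℝ)) • d)
    (hcont : Contiguous (fun n => M.sampleLaw n (θ n)) (fun n => M.sampleLaw n θ₀)) :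
    TendstoInDistribution (fun n => M.R β n (θ₀ : EuclideanSpace ℝ (Fin p))) atTop (id : ℝ → ℝ)
      (fun n => M.sampleLaw n (θ n))
      (noncentralChiSquared p
        (d ⬝ᵥ (M.J β θ₀ * (M.K β θ₀)⁻¹ * M.J β θ₀).mulVec d)) := by
  obtain ⟨B, hB, hBK⟩ := hK.exists_whitening
  have hlim := hreg.tendstoInDistribution_whitened hβ hK hKcont hθ hcont hBK
  have hcomp := TendstoInDistribution.continuous_comp
    (g := fun z : EuclideanSpace ℝ (Fin p) => ‖z‖ ^ 2) (continuous_norm.pow 2) hlim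
  have hlim' := hcomp.congr (Y := fun n => M.R β n (θ₀ : EuclideanSpace ℝ (Fin p)))
    (fun n => Eventually.of_forall fun X =>
      (DensityModel.R_eq_norm_sq (M := M) (B := B) β n θ₀ X hB).symm)
    EventuallyEq.rfl
  refine hlim'.of_map_eq aemeasurable_id ?_
  have hJ : (M.J β θ₀).transpose = M.J β θ₀ := by
    rw [← Matrix.conjTranspose_eq_transpose_of_trivial]
    exact hreg.posDef_J.isHermitian
  -- The noncentrality is the squared length of the whitened mean `B J d`, by symmetry of `J` and
  -- `K⁻¹ = Bᵀ B`.
  have hδ : d ⬝ᵥ (M.J β θ₀ * (M.K β θ₀)⁻¹ * M.J β θ₀).mulVec d =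
      ∑ i, (WithLp.toLp 2 (B.mulVec ((M.J β θ₀).mulVec d)) : EuclideanSpace ℝ (Fin p)) i ^ 2 := by
    rw [← EuclideanSpace.real_norm_sq_eq, EuclideanSpace.norm_toLp_mulVec_sq, ← hB,
      ← Matrix.mulVec_mulVec, ← Matrix.mulVec_mulVec, Matrix.dotProduct_mulVec]
    conv_lhs => rw [← hJ, Matrix.vecMul_transpose, hJ]
  rw [Measure.map_id, hδ, ← noncentralChiSquared_eq]
  exact map_norm_sq_stdGaussian_add _

end
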